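/- A max-affine arithmetic program (MAAP) is a program over real variables whose only instructions are assignments of an affine combination of variables, or of a maximum or minimum of finitely many such combinations, sequences of instructions, parallel execution of blocks (allowed only if a variable assigned in one block does not appear in another), and sequential or parallel for-loops with a constant number of iterations. It has no branching. Let $G=(V,E)$ be a finite directed graph without loops in which the reverse of every arc is an arc (arcs may have capacity $0$), let $n=|V|$, $m=|E|$, let $V$ be linearly ordered, let $s\neq t$ be nodes, and let $\vec E=\{uv\in E: u<v\}$ be the set of forward arcs. $N_v^+$, $N_v^-$ denote the successors and predecessors of $v$. For capacities $\nu\in\mathbb R_{\ge 0}^E$ and $x\in\mathbb R^{\vec E}$, let $x$ denote the flow with $\max\{x_{uv},0\}$ on $uv$ and $\max\{-x_{uv},0\}$ on $vu$, for $uv\in\vec E$; the residual capacities are $\nu_{uv}-x_{uv}$ on $uv$ and $\nu_{vu}+x_{uv}$ on $vu$, and the residual network consists of the arcs of $E$ with positive residual capacity. Consider the following program $A$ with input $(\nu_e)_{e\in E}$ and output $(x_e)_{e\in\vec E}$. For each $uv\in\vec E$ in parallel set $x_{uv}\leftarrow 0$, $c_{uv}\leftarrow\nu_{uv}$, $c_{vu}\leftarrow\nu_{vu}$.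 Then for each outer round $k=1,\dots,n-1$ do $m$ times: compute $(y_e)_{e\in\vec E}$ from $(c_e)_{e\in E}$ by the subroutine $\mathrm{FindAugmentingFlow}_k$, and then for each $uv\in\vec E$ in parallel set $x_{uv}\leftarrow x_{uv}+y_{uv}$, $c_{uv}\leftarrow c_{uv}-y_{uv}$, $c_{vu}\leftarrow c_{vu}+y_{uv}$. The subroutine $\mathrm{FindAugmentingFlow}_k$ is: 1. For all $vw\in E$ set $z_{vw}\leftarrow 0$; for all $1\le i\le k$ and $v\in V\setminus\{t\}$ set $Y^i_v\leftarrow 0$, $a_{i,v}\leftarrow 0$ (in parallel). 2. For $v\in N_t^-$ in parallel set $a_{1,v}\leftarrow c_{vt}$. For $i=2,\dots,k$, for $v\in V\setminus\{t\}$ in parallel, set $a_{i,v}\leftarrow\max_{w\in N_v^+\setminus\{t\}}\min\{a_{i-1,w},c_{vw}\}$ (no assignment if $N_v^+\setminus\{t\}=\emptyset$). 3. Set $Y^k_s\leftarrow a_{k,s}$. For $i=k,k-1,\dots,2$, for $v\in V\setminus\{t\}$ in increasing order, for $w\in N_v^+\setminus\{t\}$ in increasing order: $f\leftarrow\min\{Y^i_v,\,c_{vw},\,a_{i-1,w}-Y^{i-1}_w\}$,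 $z_{vw}\leftarrow z_{vw}+f$, $Y^i_v\leftarrow Y^i_v-f$, $Y^{i-1}_w\leftarrow Y^{i-1}_w+f$. Then for $v\in N_t^-$ in parallel: $z_{vt}\leftarrow Y^1_v$, $Y^1_v\leftarrow 0$. 4. For $i=2,\dots,k-1$, for $w\in V\setminus\{t\}$ in decreasing order, for $v\in N_w^-\setminus\{t\}$ in decreasing order: $b\leftarrow\min\{Y^i_w,z_{vw}\}$, $z_{vw}\leftarrow z_{vw}-b$, $Y^i_w\leftarrow Y^i_w-b$, $Y^{i+1}_v\leftarrow Y^{i+1}_v+b$. 5. For $uv\in\vec E$ in parallel set $y_{uv}\leftarrow z_{uv}-z_{vu}$; return $(y_e)_{e\in\vec E}$. **Theorem.** $A$ is a MAAP, and for all capacities $\nu\in\mathbb R^E_{\ge 0}$, whatever the initial values of the variables other than the input, it returns a maximum $s$-$t$-flow $(x_e)_{e\in\vec E}$. Moreover, for every $0\le r\le n-1$, after the first $r$ outer rounds $x$ is a feasible $s$-$t$-flow, $c$ is the vector of its residual capacities, and the residual network contains no $s$-$t$-path with at most $r$ arcs. -/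

import Mathlib

/-! ### Max-affine arithmetic programs -/

/-- An affine combination `b + ∑ⱼ cⱼ vⱼ` of variables from `X` with constant real coefficients. -/
structure Affine (X : Type*) where
  const : ℝ
  terms : List (ℝ × X)

namespace Affine

variable {X : Type*}

noncomputable def eval (e : Affine X) (σ : X → ℝ) : ℝ :=
  e.const + (e.terms.map fun p => p.1 * σ p.2).sum

/-- The constant `b`. -/
def num (b : ℝ) : Affine X := ⟨b, []⟩

/-- The variable `v`. -/
noncomputable def var (v : X) : Affine X := ⟨0, [(1, v)]⟩

/-- `v + w`. -/
noncomputable def add (v w : X) : Affine X := ⟨0, [(1, v), (1, w)]⟩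

/-- `v - w`. -/
noncomputable def sub (v w : X) : Affine X := ⟨0, [(1, v), (-1, w)]⟩

end Affine

/-- The expressions allowed on the right-hand side of an assignment: one affine combination, or
the maximum or minimum of a nonempty list (head and tail) of affine combinations. -/
inductive MaxAffine (X : Type*) where
  | affine (e : Affine X)
  | max (e : Affine X) (es : List (Affine X))
  | min (e : Affine X) (es : List (Affine X))

namespace MaxAffine

variable {X : Type*}

noncomputable def eval (σ : X → ℝ) : MaxAffine X → ℝ
  | affine e => e.eval σ
  | max e es => (es.map fun d => d.eval σ).foldr (fun p q => p ⊔ q) (e.eval σ)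
  | min e es => (es.map fun d => d.eval σ).foldr (fun p q => p ⊓ q) (e.eval σ)

/-- The affine combinations occurring in an expression. -/
def parts : MaxAffine X → List (Affine X)
  | affine e => [e]
  | max e es => e :: es
  | min e es => e :: es

/-- The variables occurring in an expression. -/
def vars (r : MaxAffine X) : Set X :=
  {x | ∃ e ∈ r.parts, ∃ p ∈ e.terms, p.2 = x}

end MaxAffine

/-- The instructions of a max-affine arithmetic program (MAAP) with variables from `X`.
There is no branching.  Loops have a constant number of iterations, hence a sequential (parallel)
loop is the sequential (parallel) composition of its iterations, see `forDo` and `forPar`. -/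
inductive MAAP (X : Type*) where
  | skip
  | assign (x : X) (r : MaxAffine X)
  | seq (p q : MAAP X)
  | par (p q : MAAP X)

namespace MAAP

variable {X : Type*}

/-- The variables that are assigned by a program. -/
def assigned : MAAP X → Set X
  | skip => ∅
  | assign x _ => {x}
  | seq p q => p.assigned ∪ q.assigned
  | par p q => p.assigned ∪ q.assigned

/-- The variables that appear in a program. -/
def vars : MAAP X → Set X
  | skip => ∅
  | assign x r => {x} ∪ r.vars
  | seq p q => p.vars ∪ q.vars
  | par p q => p.vars ∪ q.vars

/-- Parallel blocks must be executable in parallel: a variable that is assigned in one block does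
not appear in the other one. -/
def WellFormed : MAAP X → Prop
  | skip => True
  | assign _ _ => True
  | seq p q => p.WellFormed ∧ q.WellFormed
  | par p q => p.WellFormed ∧ q.WellFormed ∧
      Disjoint p.assigned q.vars ∧ Disjoint q.assigned p.vars

open Classical in
/-- Execution, as a map on the states (values of all variables).  Both blocks of a parallel
composition are run on the same state, and each of them contributes the variables that it
assigns. -/
noncomputable def run : MAAP X → (X → ℝ) → (X → ℝ)
  | skip, σ => σ
  | assign x r, σ => Function.update σ x (r.eval σ)
  | seq p q, σ => q.run (p.run σ)
  | par p q, σ => fun x => if x ∈ p.assigned then p.run σ x else q.run σ x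

/-- Sequence of instruction blocks. -/
def block (ps : List (MAAP X)) : MAAP X := ps.foldr seq skip

/-- **For-Do** loop over a constant list. -/
def forDo {ι : Type*} (l : List ι) (body : ι → MAAP X) : MAAP X :=
  (l.map body).foldr seq skip

/-- **For-Do-Parallel** loop over a constant list. -/
def forPar {ι : Type*} (l : List ι) (body : ι → MAAP X) : MAAP X :=
  (l.map body).foldr par skip

/-- `x ← e` for an affine combination `e`. -/
def set (x : X) (e : Affine X) : MAAP X := assign x (.affine e)

/-- `x ← max es`; over an empty list of terms there is nothing to assign. -/
def setMax (x : X) : List (Affine X) → MAAP X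
  | [] => skip
  | e :: es => assign x (.max e es)

/-- `x ← min {e, es}`. -/
def setMin (x : X) (e : Affine X) (es : List (Affine X)) : MAAP X := assign x (.min e es)

end MAAP

/-! ### Flows

A directed graph on the node set `V` is given by its finite set of arcs `E`. -/

section Flows

variable {V : Type*} [LinearOrder V]

/-- The forward arcs: those that go from a smaller to a larger node. -/
def forwardArcs (E : Finset (V × V)) : Finset (V × V) := {e ∈ E | e.1 < e.2}

/-- Outflow of `v` minus inflow of `v`. -/
def netOutflow (E : Finset (V × V)) (f : V × V → ℝ) (v : V) : ℝ :=
  ∑ e ∈ E with e.1 = v, f e - ∑ e ∈ E with e.2 = v, f e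

/-- `f` is a feasible `s`-`t`-flow for the capacities `ν`. -/
def IsFlow (E : Finset (V × V)) (s t : V) (ν f : V × V → ℝ) : Prop :=
  (∀ e ∈ E, 0 ≤ f e ∧ f e ≤ ν e) ∧ ∀ v, v ≠ s → v ≠ t → netOutflow E f v = 0

/-- `f` is an `s`-`t`-flow of maximum value, the value being the net outflow of `s`. -/
def IsMaxFlow (E : Finset (V × V)) (s t : V) (ν f : V × V → ℝ) : Prop :=
  IsFlow E s t ν f ∧ ∀ g, IsFlow E s t ν g → netOutflow E g s ≤ netOutflow E f s

/-- The flow on all arcs denoted by values `x` on the forward arcs `uv`: a positive value is flow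
on `uv`, a negative value denotes positive flow on the backward arc `vu`. -/
def arcFlow (x : V × V → ℝ) (e : V × V) : ℝ :=
  if e.1 < e.2 then max (x e) 0 else max (-x e.swap) 0

/-- The residual capacities for values `x` on the forward arcs: `ν uv - x uv` on a forward arc `uv`
and `ν vu + x uv` on the backward arc `vu`. -/
def residualCapacity (ν x : V × V → ℝ) (e : V × V) : ℝ :=
  if e.1 < e.2 then ν e - x e else ν e + x e.swap

/-- `uv` is an arc of the residual network for the residual capacities `c`. -/
def ResidualArc (E : Finset (V × V)) (c : V × V → ℝ) (u v : V) : Prop :=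
  (u, v) ∈ E ∧ 0 < c (u, v)

/-- There is a walk with exactly `k` arcs from `u` to `v` in the digraph `R`. -/
def WalkOfLength (R : V → V → Prop) : ℕ → V → V → Prop
  | 0, u, v => u = v
  | k + 1, u, v => ∃ w, R u w ∧ WalkOfLength R k w v

end Flows

/-! ### The maximum flow program -/

/-- The program variables: capacities `ν` (input), flow `x` (output), residual capacities `c`,
augmenting flow `y`, and the variables of the subroutine: flow `z`, excess `Y i v`, fattest path
values `a i v`, and the auxiliary `f`, `b`, and `g v w`. -/
inductive FlowVar (V : Type*) where
  | nu (u v : V)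
  | x (u v : V)
  | c (u v : V)
  | y (u v : V)
  | z (u v : V)
  | Y (i : ℕ) (v : V)
  | a (i : ℕ) (v : V)
  | g (v w : V)
  | f
  | b

section MaxFlow

variable {V : Type*} [Fintype V] [LinearOrder V]

/-- `V \ {t}` in index order. -/
def nodesWithout (t : V) : List V := (Finset.univ.filter fun v => v ≠ t).sort (· ≤ ·)

/-- `N⁺(v) \ {t}` in index order. -/
def succWithout (E : Finset (V × V)) (t v : V) : List V :=
  (Finset.univ.filter fun w => (v, w) ∈ E ∧ w ≠ t).sort (· ≤ ·)

/-- `N⁻(w) \ {t}` in index order. -/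
def predWithout (E : Finset (V × V)) (t w : V) : List V :=
  (Finset.univ.filter fun v => (v, w) ∈ E ∧ v ≠ t).sort (· ≤ ·)

/-- `N⁻(t)` in index order. -/
def predSink (E : Finset (V × V)) (t : V) : List V :=
  (Finset.univ.filter fun v => (v, t) ∈ E).sort (· ≤ ·)

open MAAP FlowVar

/-- The subroutine `FindAugmentingFlow_k`: initialization. -/
noncomputable def findInit (E : Finset (V × V)) (t : V) (k : ℕ) : MAAP (FlowVar V) :=
  block [
    forPar (forwardArcs E).toList fun e =>
      block [set (z e.1 e.2) (.num 0), set (z e.2 e.1) (.num 0)],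
    forPar (List.range' 1 k) fun i => forPar (nodesWithout t) fun v =>
      block [set (Y i v) (.num 0), set (a i v) (.num 0)]]

/-- The subroutine `FindAugmentingFlow_k`: fattest path values.  The nested expression
`max_w min {a (i-1) w, c v w}` is evaluated by means of the auxiliary variables `g v w`. -/
noncomputable def findFattest (E : Finset (V × V)) (t : V) (k : ℕ) : MAAP (FlowVar V) :=
  block [
    forPar (predSink E t) fun v => set (a 1 v) (.var (c v t)),
    forDo (List.range' 2 (k - 1)) fun i => forPar (nodesWithout t) fun v =>
      block [
        forPar (succWithout E t v) fun w =>
          setMin (g v w) (.var (a (i - 1) w)) [.var (c v w)],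
        setMax (a i v) ((succWithout E t v).map fun w => .var (g v w))]]

/-- The subroutine `FindAugmentingFlow_k`: pushing flow from `s` to `t`.  The outer loop runs over
`i = k, k-1, …, 2`. -/
noncomputable def findPush (E : Finset (V × V)) (s t : V) (k : ℕ) : MAAP (FlowVar V) :=
  block [
    set (Y k s) (.var (a k s)),
    forDo (List.range' 2 (k - 1)).reverse fun i =>
      forDo (nodesWithout t) fun v => forDo (succWithout E t v) fun w =>
        block [
          setMin f (.var (Y i v)) [.var (c v w), .sub (a (i - 1) w) (Y (i - 1) w)],
          set (z v w) (.add (z v w) f),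
          set (Y i v) (.sub (Y i v) f),
          set (Y (i - 1) w) (.add (Y (i - 1) w) f)],
    forPar (predSink E t) fun v =>
      block [set (z v t) (.var (Y 1 v)), set (Y 1 v) (.num 0)]]

/-- The subroutine `FindAugmentingFlow_k`: clean-up.  The outer loop runs over
`i = 2, 3, …, k-1`. -/
noncomputable def findCleanUp (E : Finset (V × V)) (t : V) (k : ℕ) : MAAP (FlowVar V) :=
  forDo (List.range' 2 (k - 2)) fun i =>
    forDo (nodesWithout t).reverse fun w => forDo (predWithout E t w).reverse fun v =>
      block [
        setMin b (.var (Y i w)) [.var (z v w)],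
        set (z v w) (.sub (z v w) b),
        set (Y i w) (.sub (Y i w) b),
        set (Y (i + 1) v) (.add (Y (i + 1) v) b)]

/-- The subroutine `FindAugmentingFlow_k`, with input `c` and output `y`. -/
noncomputable def findAugmentingFlow (E : Finset (V × V)) (s t : V) (k : ℕ) :
    MAAP (FlowVar V) :=
  block [
    findInit E t k,
    findFattest E t k,
    findPush E s t k,
    findCleanUp E t k,
    forPar (forwardArcs E).toList fun e =>
      set (y e.1 e.2) (.sub (z e.1 e.2) (z e.2 e.1))]

/-- The initialization of the maximum flow program, followed by its first `r` outer rounds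
`k = 1, …, r`, each of which consists of `m = #E` augmentations. -/
noncomputable def maxFlowRounds (E : Finset (V × V)) (s t : V) (r : ℕ) : MAAP (FlowVar V) :=
  block [
    forPar (forwardArcs E).toList fun e =>
      block [
        set (x e.1 e.2) (.num 0),
        set (c e.1 e.2) (.var (nu e.1 e.2)),
        set (c e.2 e.1) (.var (nu e.2 e.1))],
    forDo (List.range' 1 r) fun k => forDo (List.range' 1 E.card) fun _ =>
      block [
        findAugmentingFlow E s t k,
        forPar (forwardArcs E).toList fun e =>
          block [
            set (x e.1 e.2) (.add (x e.1 e.2) (y e.1 e.2)),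
            set (c e.1 e.2) (.sub (c e.1 e.2) (y e.1 e.2)),
            set (c e.2 e.1) (.add (c e.2 e.1) (y e.1 e.2))]]]

/-- The maximum flow program: all `n - 1` outer rounds. -/
noncomputable def maxFlowMAAP (E : Finset (V × V)) (s t : V) : MAAP (FlowVar V) :=
  maxFlowRounds E s t (Fintype.card V - 1)

end MaxFlow

/-! Round `k` acts like a phase of a blocking-flow algorithm. When it starts, no residual walk from
`s` to `t` has fewer than `k` arcs; the round destroys all those with exactly `k` arcs. A node on
such a walk gets as its level the number of arcs that follow it, and this number is unique. One
augmentation finds a flow on arcs between consecutive levels which, if a `k`-arc walk exists,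
saturates at least one level arc. The only residual arcs it creates are reverses of level arcs, and
these yield neither shorter walks nor new level arcs. So the number of level arcs, at most `m`,
drops until it is zero (`augmentStep_spec`). Walks can be shortened to fewer than `n` arcs, so after
`n - 1` rounds `t` is unreachable, and the cut of the reachable nodes proves maximality.

The crux is the saturated arc (`PushInv.exists_saturatedArc`). The value `a i v` is the best
bottleneck of an `i`-arc walk from `v` to `t`, and the pushes keep the supply of a level-`i` node
(its inflow, plus `a k s` at the source) at most `a i v`. Call the node full if equality holds. The
source is full; let `v` be a full node on the lowest possible level.

No excess is left on the level of `v` or below. Suppose a node `u` there kept some, and let `uw`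
attain the maximum in the recursion for its fattest value. The push along `uw` did not exhaust the
excess, so it saturated `uw` or filled `w`. The former needs more outflow than the supply of `u`
allows, the latter contradicts the choice of `v`.

Hence `v` passes on its whole positive supply. On level `1` this saturates the arc to `t`. Otherwise
the first arc out of `v` that carries flow is saturated, fills its head, or takes the whole supply
of `v`. In the last case it carries at least `min (a (i-1) w) (c v w)`, so again it is saturated or
its head is full. A full head is excluded. The clean-up moves flow only above this arc, so the
saturation survives (`CleanUpInv.step`). -/

/-! ### Max-affine programs: well-formedness, execution and loop invariants -/

namespace MAAP

variable {X ι : Type*}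

@[simp] theorem block_nil : block ([] : List (MAAP X)) = skip := rfl

@[simp] theorem block_cons (p : MAAP X) (ps : List (MAAP X)) :
    block (p :: ps) = seq p (block ps) := rfl

@[simp] theorem forDo_nil (body : ι → MAAP X) : forDo [] body = skip := rfl

@[simp] theorem forPar_nil (body : ι → MAAP X) : forPar [] body = skip := rfl

@[simp] theorem forDo_cons (i : ι) (l : List ι) (body : ι → MAAP X) :
    forDo (i :: l) body = seq (body i) (forDo l body) := rfl

@[simp] theorem forPar_cons (i : ι) (l : List ι) (body : ι → MAAP X) :
    forPar (i :: l) body = par (body i) (forPar l body) := rfl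

@[simp] theorem assigned_forDo (l : List ι) (body : ι → MAAP X) (x : X) :
    x ∈ (forDo l body).assigned ↔ ∃ i ∈ l, x ∈ (body i).assigned := by
  induction l with
  | nil => simp [assigned]
  | cons i l ih => simp [assigned, ih]

@[simp] theorem assigned_forPar (l : List ι) (body : ι → MAAP X) (x : X) :
    x ∈ (forPar l body).assigned ↔ ∃ i ∈ l, x ∈ (body i).assigned := by
  induction l with
  | nil => simp [assigned]
  | cons i l ih => simp [assigned, ih]

@[simp] theorem vars_forDo (l : List ι) (body : ι → MAAP X) (x : X) :
    x ∈ (forDo l body).vars ↔ ∃ i ∈ l, x ∈ (body i).vars := by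
  induction l with
  | nil => simp [vars]
  | cons i l ih => simp [vars, ih]

@[simp] theorem vars_forPar (l : List ι) (body : ι → MAAP X) (x : X) :
    x ∈ (forPar l body).vars ↔ ∃ i ∈ l, x ∈ (body i).vars := by
  induction l with
  | nil => simp [vars]
  | cons i l ih => simp [vars, ih]

@[simp] theorem assigned_setMax (x : X) (es : List (Affine X)) (y : X) :
    y ∈ (setMax x es).assigned ↔ es ≠ [] ∧ y = x := by
  cases es <;> simp [setMax, assigned]

@[simp] theorem vars_setMax (x : X) (es : List (Affine X)) (y : X) :
    y ∈ (setMax x es).vars ↔ es ≠ [] ∧ (y = x ∨ ∃ e ∈ es, ∃ p ∈ e.terms, p.2 = y) := by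
  cases es <;> simp [setMax, vars, MaxAffine.vars, MaxAffine.parts]

theorem wellFormed_setMax (x : X) (es : List (Affine X)) : (setMax x es).WellFormed := by
  cases es <;> simp [setMax, WellFormed]

theorem wellFormed_block {ps : List (MAAP X)} (h : ∀ p ∈ ps, p.WellFormed) :
    (block ps).WellFormed := by
  induction ps with
  | nil => trivial
  | cons p ps ih =>
    exact ⟨h p (by simp), ih fun q hq => h q (by simp [hq])⟩

theorem wellFormed_forDo {l : List ι} {body : ι → MAAP X} (h : ∀ i ∈ l, (body i).WellFormed) :
    (forDo l body).WellFormed := by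
  induction l with
  | nil => trivial
  | cons i l ih => exact ⟨h i (by simp), ih fun j hj => h j (by simp [hj])⟩

/-- Repetitions in the list must be excluded: two copies of an iteration assign the same variables.
-/
theorem wellFormed_forPar {l : List ι} {body : ι → MAAP X} (hl : l.Nodup)
    (h : ∀ i ∈ l, (body i).WellFormed)
    (hd : ∀ i ∈ l, ∀ j ∈ l, i ≠ j → ∀ x ∈ (body i).assigned, x ∉ (body j).vars) :
    (forPar l body).WellFormed := by
  induction l with
  | nil => trivial
  | cons i l ih =>
    rw [List.nodup_cons] at hl
    refine ⟨h i (by simp), ih hl.2 (fun j hj => h j (by simp [hj]))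
      (fun a ha b hb => hd a (by simp [ha]) b (by simp [hb])), ?_, ?_⟩
    · rw [Set.disjoint_left]
      intro x hx hx'
      obtain ⟨j, hj, hxj⟩ := (vars_forPar _ _ _).1 hx'
      exact hd i (by simp) j (by simp [hj]) (fun h => hl.1 (h ▸ hj)) x hx hxj
    · rw [Set.disjoint_left]
      intro x hx hx'
      obtain ⟨j, hj, hxj⟩ := (assigned_forPar _ _ _).1 hx
      exact hd j (by simp [hj]) i (by simp) (fun h => hl.1 (h ▸ hj)) x hxj hx'

theorem run_of_notMem_assigned (p : MAAP X) {x : X} (hx : x ∉ p.assigned) (σ : X → ℝ) :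
    p.run σ x = σ x := by
  induction p generalizing σ with
  | skip => rfl
  | assign y r =>
    simp only [assigned, Set.mem_singleton_iff] at hx
    simp [run, hx]
  | seq p q ihp ihq =>
    simp only [assigned, Set.mem_union, not_or] at hx
    simp [run, ihp hx.1, ihq hx.2]
  | par p q ihp ihq =>
    simp only [assigned, Set.mem_union, not_or] at hx
    simp [run, hx.1, ihq hx.2]

/-- All blocks of a parallel composition start from the same state, so the final value of a variable
comes from the only iteration that assigns it. -/
theorem run_forPar_of_mem {l : List ι} {body : ι → MAAP X} {i : ι} {x : X} (hi : i ∈ l)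
    (hx : x ∈ (body i).assigned) (h : ∀ j ∈ l, x ∈ (body j).assigned → j = i) (σ : X → ℝ) :
    (forPar l body).run σ x = (body i).run σ x := by
  induction l with
  | nil => simp at hi
  | cons j l ih =>
    rw [forPar_cons, run]
    beta_reduce
    by_cases hj : x ∈ (body j).assigned
    · rw [if_pos hj, h j (by simp) hj]
    · rw [if_neg hj]
      refine ih ?_ fun j hj => h j (by simp [hj])
      rcases List.mem_cons.1 hi with rfl | hi
      · exact absurd hx hj
      · exact hi

/-- Induction along a sequential loop, with an invariant that depends on the list of the
remaining iterations. -/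
theorem forDo_induction {body : ι → MAAP X} (P : List ι → (X → ℝ) → Prop) {l : List ι}
    (hl : l.Nodup)
    (step : ∀ i l' σ, i ∈ l → i ∉ l' → (∀ j ∈ l', j ∈ l) → P (i :: l') σ → P l' ((body i).run σ))
    {σ : X → ℝ} (h : P l σ) : P [] ((forDo l body).run σ) := by
  induction l generalizing σ with
  | nil => exact h
  | cons i l ih =>
    rw [List.nodup_cons] at hl
    refine ih hl.2 (fun j l' σ hj hj' hl' => step j l' σ (by simp [hj]) hj'
      fun a ha => by simp [hl' a ha]) ?_
    exact step i l σ (by simp) hl.1 (fun a ha => by simp [ha]) h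

/-- Induction along `for i = m, m + 1, …, m + n - 1 do`. -/
theorem forDo_range'_induction {body : ℕ → MAAP X} (P : ℕ → (X → ℝ) → Prop) (m n : ℕ)
    (step : ∀ i σ, m ≤ i → i < m + n → P i σ → P (i + 1) ((body i).run σ))
    {σ : X → ℝ} (h : P m σ) : P (m + n) ((forDo (List.range' m n) body).run σ) := by
  induction n generalizing m σ with
  | zero => exact h
  | succ n ih =>
    rw [List.range'_succ, forDo_cons, run]
    have := ih (m + 1) (fun i σ h1 h2 => step i σ (by omega) (by omega))
      (step m σ le_rfl (by omega) h)
    rwa [show m + 1 + n = m + (n + 1) by omega] at this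

/-- Induction along `for i = m + n - 1, …, m + 1, m do`. -/
theorem forDo_reverse_range'_induction {body : ℕ → MAAP X} (P : ℕ → (X → ℝ) → Prop) (m n : ℕ)
    (step : ∀ i σ, m ≤ i → i < m + n → P (i + 1) σ → P i ((body i).run σ))
    {σ : X → ℝ} (h : P (m + n) σ) :
    P m ((forDo (List.range' m n).reverse body).run σ) := by
  induction n generalizing σ with
  | zero => exact h
  | succ n ih =>
    rw [List.range'_concat, List.reverse_append, List.reverse_singleton, List.singleton_append,
      forDo_cons, run, one_mul]
    exact ih (fun i σ h1 h2 => step i σ h1 (by omega))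
      (step (m + n) σ (by omega) (by omega) h)

end MAAP

/-! ### Walks: concatenation, splitting, shortening -/

section Walks

variable {V : Type*} {R : V → V → Prop}

theorem WalkOfLength.append {i j : ℕ} {u v w : V} (h : WalkOfLength R i u v)
    (h' : WalkOfLength R j v w) : WalkOfLength R (i + j) u w := by
  induction i generalizing u with
  | zero =>
    cases h
    simpa using h'
  | succ i ih =>
    obtain ⟨a, ha, h⟩ := h
    rw [show i + 1 + j = (i + j) + 1 by omega]
    exact ⟨a, ha, ih h⟩

theorem WalkOfLength.split {i j : ℕ} {u w : V} (h : WalkOfLength R (i + j) u w) :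
    ∃ v, WalkOfLength R i u v ∧ WalkOfLength R j v w := by
  induction i generalizing u with
  | zero => exact ⟨u, rfl, by simpa using h⟩
  | succ i ih =>
    rw [show i + 1 + j = (i + j) + 1 by omega] at h
    obtain ⟨a, ha, h⟩ := h
    obtain ⟨v, h1, h2⟩ := ih h
    exact ⟨v, ⟨a, ha, h1⟩, h2⟩

theorem WalkOfLength.snoc {i : ℕ} {u v w : V} (h : WalkOfLength R i u v) (h' : R v w) :
    WalkOfLength R (i + 1) u w :=
  h.append (j := 1) ⟨w, h', rfl⟩

/-- A walk can be shortened to one with fewer arcs than there are nodes. -/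
theorem WalkOfLength.exists_lt_card [Fintype V] {k : ℕ} {u w : V} (h : WalkOfLength R k u w) :
    ∃ j < Fintype.card V, WalkOfLength R j u w := by
  classical
  have hex : ∃ j, WalkOfLength R j u w := ⟨k, h⟩
  refine ⟨Nat.find hex, ?_, Nat.find_spec hex⟩
  by_contra! hlt
  -- A shortest walk is split at each of its positions. With at least `Fintype.card V` arcs two of
  -- the splitting nodes coincide, and joining the earlier prefix to the later suffix gives a
  -- shorter walk.
  have hsplit : ∀ i : Fin (Nat.find hex + 1),
      ∃ v, WalkOfLength R i u v ∧ WalkOfLength R (Nat.find hex - i) v w := fun i =>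
    WalkOfLength.split (by
      rw [show (i : ℕ) + (Nat.find hex - i) = Nat.find hex by omega]
      exact Nat.find_spec hex)
  choose v hv1 hv2 using hsplit
  obtain ⟨i, j, hij, hv⟩ := Fintype.exists_ne_map_eq_of_card_lt v (by rw [Fintype.card_fin]; omega)
  have key : ∀ i j : Fin (Nat.find hex + 1), i < j → v i = v j → False := fun i j hlt hv => by
    have hw := (hv1 i).append (hv ▸ hv2 j)
    have := Nat.find_min' hex hw
    have : (i : ℕ) < j := hlt
    omega
  rcases lt_or_gt_of_ne hij with h | h
  · exact key i j h hv
  · exact key j i h hv.symm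

end Walks

/-! ### Levels of the residual network and their behaviour under augmentation -/

section Levels

variable {V : Type*} {E : Finset (V × V)} {c c' : V × V → ℝ} {s t : V} {k : ℕ}

/-- `v` lies on level `j`: it is on a residual walk with `k` arcs from `s` to `t`, and is followed
by `j` arcs of this walk. -/
def OnLevel (E : Finset (V × V)) (c : V × V → ℝ) (s t : V) (k j : ℕ) (v : V) : Prop :=
  ∃ i, i + j = k ∧ WalkOfLength (ResidualArc E c) i s v ∧ WalkOfLength (ResidualArc E c) j v t

/-- There is no residual walk from `s` to `t` with fewer than `k` arcs. -/
def NoShortWalk (E : Finset (V × V)) (c : V × V → ℝ) (s t : V) (k : ℕ) : Prop :=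
  ∀ i < k, ¬ WalkOfLength (ResidualArc E c) i s t

/-- If a node lay on two levels, the short way from `s` to it and the short way from it to `t` would
together have fewer than `k` arcs. -/
theorem NoShortWalk.level_unique (H : NoShortWalk E c s t k) {i j : ℕ} {v : V}
    (hi : OnLevel E c s t k i v) (hj : OnLevel E c s t k j v) : i = j := by
  obtain ⟨i', hi', hi1, hi2⟩ := hi
  obtain ⟨j', hj', hj1, hj2⟩ := hj
  by_contra hne
  rcases lt_or_gt_of_ne hne with h | h
  · exact H _ (by omega) (hj1.append hi2)
  · exact H _ (by omega) (hi1.append hj2)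

theorem OnLevel.le {j : ℕ} {v : V} (h : OnLevel E c s t k j v) : j ≤ k := by
  obtain ⟨i, hi, -⟩ := h
  omega

theorem OnLevel.walk {j : ℕ} {v : V} (h : OnLevel E c s t k j v) :
    WalkOfLength (ResidualArc E c) k s t := by
  obtain ⟨i, hi, h1, h2⟩ := h
  exact hi ▸ h1.append h2

theorem OnLevel.eq_source {v : V} (h : OnLevel E c s t k k v) : v = s := by
  obtain ⟨i, hi, h1, -⟩ := h
  obtain rfl : i = 0 := by omega
  exact Eq.symm h1

theorem OnLevel.eq_sink {v : V} (h : OnLevel E c s t k 0 v) : v = t := by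
  obtain ⟨i, hi, -, h2⟩ := h
  exact h2

theorem NoShortWalk.ne_sink (H : NoShortWalk E c s t k) {j : ℕ} {v : V}
    (h : OnLevel E c s t k j v) (hj : 1 ≤ j) : v ≠ t := by
  rintro rfl
  have := H.level_unique h ⟨k, Nat.add_zero k, h.walk, rfl⟩
  omega

theorem NoShortWalk.ne_source (H : NoShortWalk E c s t k) {j : ℕ} {v : V}
    (h : OnLevel E c s t k j v) (hj : j < k) : v ≠ s := by
  rintro rfl
  have := H.level_unique h ⟨0, Nat.zero_add k, rfl, h.walk⟩
  omega

theorem onLevel_source (h : WalkOfLength (ResidualArc E c) k s t) : OnLevel E c s t k k s :=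
  ⟨0, Nat.zero_add k, rfl, h⟩

/-- The residual network for `c'` arises from that for `c` by deleting arcs and by adding reverse
arcs of arcs between consecutive levels. -/
def IsLevelUpdate (E : Finset (V × V)) (c c' : V × V → ℝ) (s t : V) (k : ℕ) : Prop :=
  ∀ u v, ResidualArc E c' u v → ResidualArc E c u v ∨
    ∃ j, OnLevel E c s t k (j + 1) v ∧ OnLevel E c s t k j u

/-- Distances from `s` do not decrease. A new arc leads from level `p` to level `p + 1`, hence one
step back towards `s`: its head already has an old walk of length `k - p - 1`, while every old walk
to its tail has at least `k - p` arcs. -/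
theorem IsLevelUpdate.exists_walk_le (hu : IsLevelUpdate E c c' s t k)
    (H : NoShortWalk E c s t k) {i : ℕ} {v : V} (h : WalkOfLength (ResidualArc E c') i s v) :
    ∃ j ≤ i, WalkOfLength (ResidualArc E c) j s v := by
  induction i generalizing v with
  | zero => exact ⟨0, le_rfl, h⟩
  | succ i ih =>
    obtain ⟨u, h1, w, h2, rfl⟩ := h.split
    obtain ⟨j, hj, hw⟩ := ih h1
    rcases hu _ _ h2 with h2 | ⟨p, ⟨q, hq, hq1, -⟩, ⟨_, -, -, hp2⟩⟩
    · exact ⟨j + 1, by omega, hw.snoc h2⟩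
    · refine ⟨q, ?_, hq1⟩
      by_contra hlt
      exact H _ (by omega) (hw.append hp2)

/-- A walk with at most `k` arcs in total has no slack for a new arc: such an arc loses a level, and
replacing the part up to its head by an old walk would leave fewer than `k` arcs, contrary to the
induction hypothesis. -/
theorem IsLevelUpdate.walk_to_sink (hu : IsLevelUpdate E c c' s t k)
    (H : NoShortWalk E c s t k) {i j : ℕ} {v : V} (h : WalkOfLength (ResidualArc E c) i s v)
    (h' : WalkOfLength (ResidualArc E c') j v t) (hij : i + j ≤ k) :
    i + j = k ∧ WalkOfLength (ResidualArc E c) j v t := by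
  induction j generalizing i v with
  | zero =>
    obtain rfl : v = t := h'
    refine ⟨?_, rfl⟩
    by_contra hne
    exact H _ (by omega) h
  | succ j ih =>
    obtain ⟨w, h2, h'⟩ := h'
    rcases hu _ _ h2 with h2 | ⟨p, ⟨q, hq, hq1, -⟩, ⟨_, -, -, hp2⟩⟩
    · obtain ⟨h3, h4⟩ := ih (h.snoc h2) h' (by omega)
      exact ⟨by omega, w, h2, h4⟩
    · have h3 : k ≤ i + p := by
        by_contra hlt
        exact H _ (by omega) (h.append hp2)
      have := (ih hq1 h' (by omega)).1
      omega

theorem IsLevelUpdate.noShortWalk (hu : IsLevelUpdate E c c' s t k) (H : NoShortWalk E c s t k) :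
    NoShortWalk E c' s t k := fun i hi h => by
  obtain ⟨j, hj, hw⟩ := hu.exists_walk_le H h
  exact H j (by omega) hw

open Classical in
/-- The residual arcs between consecutive levels. -/
noncomputable def levelArcs (E : Finset (V × V)) (c : V × V → ℝ) (s t : V) (k : ℕ) :
    Finset (V × V) :=
  {e ∈ E | 0 < c e ∧ ∃ j, OnLevel E c s t k (j + 1) e.1 ∧ OnLevel E c s t k j e.2}

theorem card_levelArcs_le : (levelArcs E c s t k).card ≤ E.card :=
  Finset.card_le_card fun e he => by
    simp only [levelArcs, Finset.mem_filter] at he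
    exact he.1

/-- A new level arc lies on a new walk with `k` arcs. By the two preceding lemmas its ends keep
their levels in the old network, and the arc itself cannot be one of the added reverse arcs. -/
theorem IsLevelUpdate.levelArcs_subset (hu : IsLevelUpdate E c c' s t k)
    (H : NoShortWalk E c s t k) : levelArcs E c' s t k ⊆ levelArcs E c s t k := by
  rintro ⟨u, v⟩ he
  simp only [levelArcs, Finset.mem_filter] at he ⊢
  obtain ⟨hE, hc, j, ⟨i, hi, hi1, hi2⟩, ⟨_, -, -, hj2⟩⟩ := he
  obtain ⟨i', hi', hw⟩ := hu.exists_walk_le H hi1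
  obtain ⟨h3, h4⟩ := hu.walk_to_sink H hw hi2 (by omega)
  obtain rfl : i' = i := by omega
  rcases hu u v ⟨hE, hc⟩ with h | ⟨p, ⟨q, hq, hq1, -⟩, ⟨_, -, -, hp2⟩⟩
  · obtain ⟨h5, h6⟩ := hu.walk_to_sink H (hw.snoc h) hj2 (by omega)
    exact ⟨hE, h.2, j, ⟨i', hi, hw, h4⟩, ⟨i' + 1, h5, hw.snoc h, h6⟩⟩
  · have h5 : k ≤ i' + p := by
      by_contra hlt
      exact H _ (by omega) (hw.append hp2)
    have := (hu.walk_to_sink H hq1 hj2 (by omega)).1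
    omega

theorem levelArcs_nonempty (hk : 1 ≤ k) (h : WalkOfLength (ResidualArc E c) k s t) :
    (levelArcs E c s t k).Nonempty := by
  obtain ⟨j, rfl⟩ : ∃ j, k = j + 1 := ⟨k - 1, by omega⟩
  obtain ⟨w, h1, h2⟩ := h
  refine ⟨(s, w), ?_⟩
  simp only [levelArcs, Finset.mem_filter]
  exact ⟨h1.1, h1.2, j, onLevel_source ⟨w, h1, h2⟩, 1, by omega, ⟨w, h1, rfl⟩, h2⟩

end Levels

/-! ### Net outflow, cuts, and optimality -/

section Sums

variable {V : Type*} [LinearOrder V] {E : Finset (V × V)} {s t : V}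

/-- The outflow of `v`. -/
def outSum (E : Finset (V × V)) (f : V × V → ℝ) (v : V) : ℝ := ∑ e ∈ E with e.1 = v, f e

/-- The inflow of `v`. -/
def inSum (E : Finset (V × V)) (f : V × V → ℝ) (v : V) : ℝ := ∑ e ∈ E with e.2 = v, f e

theorem netOutflow_eq (f : V × V → ℝ) (v : V) : netOutflow E f v = outSum E f v - inSum E f v :=
  rfl

omit [LinearOrder V] in
theorem sum_filter_swap (hsymm : ∀ u v, (u, v) ∈ E → (v, u) ∈ E) (p : V × V → Prop)
    [DecidablePred p] (f : V × V → ℝ) :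
    ∑ e ∈ E with p e, f e = ∑ e ∈ E with p e.swap, f e.swap := by
  refine Finset.sum_nbij' Prod.swap Prod.swap ?_ ?_ ?_ ?_ ?_ <;> aesop

theorem inSum_eq (hsymm : ∀ u v, (u, v) ∈ E → (v, u) ∈ E) (f : V × V → ℝ) (v : V) :
    inSum E f v = outSum E (fun e => f e.swap) v :=
  sum_filter_swap hsymm (fun e => e.2 = v) f

/-- The positive and negative parts of `x` recombine. This turns statements about `arcFlow` into
linear ones about residual capacities. -/
theorem arcFlow_sub_swap (hloop : ∀ v, (v, v) ∉ E) (ν x : V × V → ℝ) {e : V × V} (he : e ∈ E) :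
    arcFlow x e - arcFlow x e.swap = ν e - residualCapacity ν x e := by
  obtain ⟨u, v⟩ := e
  have hne : u ≠ v := by
    rintro rfl
    exact hloop _ he
  have hmax : ∀ a : ℝ, max a 0 - max (-a) 0 = a := fun a => by
    rcases le_total a 0 with h | h
    · rw [max_eq_right h, max_eq_left (by linarith)]; ring
    · rw [max_eq_left h, max_eq_right (by linarith)]; ring
  rcases lt_or_gt_of_ne hne with h | h
  · simp [arcFlow, residualCapacity, h, not_lt.2 h.le, hmax]
  · have := hmax (x (v, u))
    simp [arcFlow, residualCapacity, h, not_lt.2 h.le]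
    linarith

theorem netOutflow_arcFlow (hloop : ∀ v, (v, v) ∉ E) (hsymm : ∀ u v, (u, v) ∈ E → (v, u) ∈ E)
    {ν x c : V × V → ℝ} (hc : ∀ e ∈ E, c e = residualCapacity ν x e) (v : V) :
    netOutflow E (arcFlow x) v = outSum E (fun e => ν e - c e) v := by
  rw [netOutflow_eq, inSum_eq hsymm, outSum, outSum, ← Finset.sum_sub_distrib, outSum]
  refine Finset.sum_congr rfl fun e he => ?_
  rw [arcFlow_sub_swap hloop ν x (Finset.mem_filter.1 he).1, hc e (Finset.mem_filter.1 he).1]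

/-- Values on the forward arcs with nonnegative residual capacities denote a flow that respects
the capacities. -/
theorem arcFlow_mem_Icc {ν x : V × V → ℝ} (hν : ∀ e ∈ E, 0 ≤ ν e)
    (hc : ∀ e ∈ E, 0 ≤ residualCapacity ν x e) {e : V × V} (he : e ∈ E) :
    0 ≤ arcFlow x e ∧ arcFlow x e ≤ ν e := by
  obtain ⟨u, v⟩ := e
  have h1 := hc _ he
  have h2 := hν _ he
  unfold residualCapacity at h1
  unfold arcFlow
  split_ifs at h1 ⊢ with h
  · exact ⟨le_max_right _ _, max_le (by linarith) h2⟩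
  · exact ⟨le_max_right _ _, max_le (by linarith) h2⟩

theorem sum_netOutflow (hsymm : ∀ u v, (u, v) ∈ E → (v, u) ∈ E) (f : V × V → ℝ) (S : Finset V) :
    ∑ v ∈ S, netOutflow E f v = ∑ e ∈ E with e.1 ∈ S ∧ e.2 ∉ S, (f e - f e.swap) := by
  have h1 : ∑ v ∈ S, netOutflow E f v
      = ∑ e ∈ E with e.1 ∈ S, f e - ∑ e ∈ E with e.2 ∈ S, f e := by
    simp only [netOutflow, Finset.sum_sub_distrib]
    simp only [Finset.sum_filter]
    rw [Finset.sum_comm, Finset.sum_comm (s := S)]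
    simp
  have h2 := Finset.sum_filter_add_sum_filter_not {e ∈ E | e.1 ∈ S} (fun e => e.2 ∈ S) f
  have h3 := Finset.sum_filter_add_sum_filter_not {e ∈ E | e.2 ∈ S} (fun e => e.1 ∈ S) f
  simp only [Finset.filter_filter] at h2 h3
  have h4 := sum_filter_swap hsymm (fun e => e.2 ∈ S ∧ e.1 ∉ S) f
  simp only [Prod.fst_swap, Prod.snd_swap] at h4
  simp only [and_comm (a := _ ∈ S) (b := _ ∈ S)] at h2 h3
  rw [h1, Finset.sum_sub_distrib, ← h2, ← h3, h4]
  ring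

/-- A flow without residual walk from `s` to `t` is maximum. -/
theorem isMaxFlow_of_no_residual_walk [Fintype V] (hloop : ∀ v, (v, v) ∉ E)
    (hsymm : ∀ u v, (u, v) ∈ E → (v, u) ∈ E) {ν x c : V × V → ℝ}
    (hx : IsFlow E s t ν (arcFlow x)) (hc : ∀ e ∈ E, c e = residualCapacity ν x e)
    (hno : ∀ k, ¬ WalkOfLength (ResidualArc E c) k s t) : IsMaxFlow E s t ν (arcFlow x) := by
  classical
  refine ⟨hx, fun g hg => ?_⟩
  let S : Finset V := {v | ∃ k, WalkOfLength (ResidualArc E c) k s v}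
  have hs : s ∈ S := by
    simp only [S, Finset.mem_filter, Finset.mem_univ, true_and]
    exact ⟨0, rfl⟩
  have ht : t ∉ S := by
    simpa [S] using hno
  -- Since `t ∉ S`, conservation removes every node of `S` except `s`; the value of any flow is thus
  -- its net flow across the cut.
  have hsum : ∀ f, IsFlow E s t ν f → netOutflow E f s = ∑ v ∈ S, netOutflow E f v := by
    intro f hf
    rw [Finset.sum_eq_single_of_mem s hs]
    intro v hv hvs
    exact hf.2 v hvs fun h => ht (h ▸ hv)
  rw [hsum g hg, hsum _ hx, sum_netOutflow hsymm, sum_netOutflow hsymm]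
  refine Finset.sum_le_sum fun e he => ?_
  obtain ⟨hE, h1, h2⟩ := Finset.mem_filter.1 he
  rw [arcFlow_sub_swap hloop ν x hE, ← hc e hE]
  -- An arc leaving `S` with positive residual capacity would make its head reachable.
  have hce : c e ≤ 0 := by
    by_contra! hpos
    apply h2
    simp only [S, Finset.mem_filter, Finset.mem_univ, true_and] at h1 ⊢
    obtain ⟨k, hk⟩ := h1
    exact ⟨k + 1, hk.snoc ⟨hE, hpos⟩⟩
  have := (hg.1 e hE).2
  have := (hg.1 e.swap (hsymm _ _ hE)).1
  linarith

end Sums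

/-! ### Effect of changing the flow on a single arc -/

section Shift

variable {V : Type*} [LinearOrder V] {E : Finset (V × V)}

/-- Raise the flow on `vw` by `F`. -/
def shiftFlow (z : V × V → ℝ) (v w : V) (F : ℝ) (e : V × V) : ℝ :=
  z e + if e = (v, w) then F else 0

/-- Move excess `F` from `v` on level `j + 1` to `w` on level `j`. -/
def shiftExcess (Y : ℕ → V → ℝ) (j : ℕ) (v w : V) (F : ℝ) (i : ℕ) (u : V) : ℝ :=
  Y i u - (if i = j + 1 ∧ u = v then F else 0) + if i = j ∧ u = w then F else 0

@[simp] theorem shiftFlow_zero (z : V × V → ℝ) (v w : V) : shiftFlow z v w 0 = z := by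
  funext e
  simp [shiftFlow]

@[simp] theorem shiftExcess_zero (Y : ℕ → V → ℝ) (j : ℕ) (v w : V) :
    shiftExcess Y j v w 0 = Y := by
  funext i u
  simp [shiftExcess]

theorem outSum_shiftFlow {v w : V} (h : (v, w) ∈ E) (z : V × V → ℝ) (F : ℝ) (u : V) :
    outSum E (shiftFlow z v w F) u = outSum E z u + if u = v then F else 0 := by
  simp only [outSum, shiftFlow, Finset.sum_add_distrib, Finset.sum_ite_eq', Finset.mem_filter, h,
    true_and, eq_comm (a := v)]

theorem inSum_shiftFlow {v w : V} (h : (v, w) ∈ E) (z : V × V → ℝ) (F : ℝ) (u : V) :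
    inSum E (shiftFlow z v w F) u = inSum E z u + if u = w then F else 0 := by
  simp only [inSum, shiftFlow, Finset.sum_add_distrib, Finset.sum_ite_eq', Finset.mem_filter, h,
    true_and, eq_comm (a := w)]

/-- The inflow of `v`, where the source is supplied with `S`. -/
def supply (E : Finset (V × V)) (s : V) (S : ℝ) (z : V × V → ℝ) (v : V) : ℝ :=
  inSum E z v + if v = s then S else 0

theorem supply_shiftFlow {v w : V} (h : (v, w) ∈ E) (s : V) (S : ℝ) (z : V × V → ℝ) (F : ℝ)
    (u : V) :
    supply E s S (shiftFlow z v w F) u = supply E s S z u + if u = w then F else 0 := by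
  rw [supply, inSum_shiftFlow h, supply]
  ring

theorem le_outSum {z : V × V → ℝ} (hz : ∀ e ∈ E, 0 ≤ z e) {v w : V} (h : (v, w) ∈ E) :
    z (v, w) ≤ outSum E z v :=
  Finset.single_le_sum (f := z) (fun e he => hz e (Finset.mem_filter.1 he).1)
    (Finset.mem_filter.2 ⟨h, rfl⟩)

theorem le_inSum {z : V × V → ℝ} (hz : ∀ e ∈ E, 0 ≤ z e) {v w : V} (h : (v, w) ∈ E) :
    z (v, w) ≤ inSum E z w :=
  Finset.single_le_sum (f := z) (fun e he => hz e (Finset.mem_filter.1 he).1)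
    (Finset.mem_filter.2 ⟨h, rfl⟩)

end Shift

/-! ### Fattest path values and the invariant of the pushing phase -/

section Push

variable {V : Type*} [LinearOrder V] {E : Finset (V × V)} {c : V × V → ℝ} {s t : V} {k : ℕ}
  {a : ℕ → V → ℝ}

/-- `a i v` is the maximum bottleneck capacity of a walk with `i` arcs from `v` to `t` in which
`t` is not an inner node. -/
structure IsFattest (E : Finset (V × V)) (c : V × V → ℝ) (t : V) (k : ℕ) (a : ℕ → V → ℝ) :
    Prop where
  nonneg : ∀ i v, 1 ≤ i → i ≤ k → v ≠ t → 0 ≤ a i v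
  one_of_mem : ∀ v, (v, t) ∈ E → a 1 v = c (v, t)
  one_of_notMem : ∀ v, v ≠ t → (v, t) ∉ E → a 1 v = 0
  le : ∀ i v w, 1 ≤ i → i + 1 ≤ k → v ≠ t → w ≠ t → (v, w) ∈ E →
    min (a i w) (c (v, w)) ≤ a (i + 1) v
  exists_le : ∀ i v, 1 ≤ i → i + 1 ≤ k → v ≠ t → 0 < a (i + 1) v →
    ∃ w, w ≠ t ∧ (v, w) ∈ E ∧ a (i + 1) v ≤ min (a i w) (c (v, w))

/-- Following the maximizing successors leads to `t`. Together with `IsFattest.pos` this lets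
positivity of `a` decide whether a node at the right distance from `s` is on a level. -/
theorem IsFattest.walk (ha : IsFattest E c t k a) {i : ℕ} {v : V} (hi : 1 ≤ i) (hik : i ≤ k)
    (hv : v ≠ t) (h : 0 < a i v) : WalkOfLength (ResidualArc E c) i v t := by
  induction i, hi using Nat.le_induction generalizing v with
  | base =>
    by_cases hE : (v, t) ∈ E
    · exact ⟨t, ⟨hE, ha.one_of_mem v hE ▸ h⟩, rfl⟩
    · rw [ha.one_of_notMem v hv hE] at h
      exact absurd h (lt_irrefl 0)
  | succ i hi ih =>
    obtain ⟨w, hw, hE, hle⟩ := ha.exists_le i v hi hik hv h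
    have := lt_min_iff.1 (h.trans_le hle)
    exact ⟨w, ⟨hE, this.2⟩, ih (by omega) hw this.1⟩

omit [LinearOrder V] in
theorem IsFattest.pos (ha : IsFattest E c t k a) (H : NoShortWalk E c s t k) {i : ℕ} {v : V}
    (hi : 1 ≤ i) (h : OnLevel E c s t k i v) : 0 < a i v := by
  induction i, hi using Nat.le_induction generalizing v with
  | base =>
    obtain ⟨-, -, -, w, hw, rfl⟩ := h
    rw [ha.one_of_mem v hw.1]
    exact hw.2
  | succ i hi ih =>
    have hvt := H.ne_sink h (by omega)
    have hik := h.le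
    obtain ⟨p, hp, h1, w, hw, h2⟩ := h
    have hlw : OnLevel E c s t k i w := ⟨p + 1, by omega, h1.snoc hw, h2⟩
    exact (lt_min (ih hlw) hw.2).trans_le
      (ha.le i v w hi hik hvt (H.ne_sink hlw hi) hw.1)

/-- The invariant of the pushing phase while excess is pushed from level `j + 1` to level `j` and
the arcs in `rem` are still to be treated. -/
structure PushInv (E : Finset (V × V)) (c : V × V → ℝ) (s t : V) (k : ℕ) (a : ℕ → V → ℝ) (j : ℕ)
    (rem : V → V → Prop) (z : V × V → ℝ) (Y : ℕ → V → ℝ) : Prop where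
  Y_nonneg : ∀ i v, 1 ≤ i → i ≤ k → v ≠ t → 0 ≤ Y i v
  Y_le : ∀ i v, 1 ≤ i → i ≤ k → v ≠ t → Y i v ≤ a i v
  Y_level : ∀ i v, 1 ≤ i → i ≤ k → v ≠ t → Y i v ≠ 0 → OnLevel E c s t k i v
  Y_zero : ∀ i v, 1 ≤ i → i < j → v ≠ t → Y i v = 0
  z_nonneg : ∀ e ∈ E, 0 ≤ z e
  z_le : ∀ e ∈ E, z e ≤ c e
  z_level : ∀ e ∈ E, z e ≠ 0 →
    ∃ i, j ≤ i ∧ 1 ≤ i ∧ OnLevel E c s t k (i + 1) e.1 ∧ OnLevel E c s t k i e.2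
  z_rem : ∀ v w, (v, w) ∈ E → rem v w → OnLevel E c s t k (j + 1) v → z (v, w) = 0
  balance : ∀ i v, 1 ≤ i → OnLevel E c s t k i v →
    Y i v + outSum E z v = supply E s (a k s) z v
  supply_le : ∀ i v, 1 ≤ i → OnLevel E c s t k i v → supply E s (a k s) z v ≤ a i v
  -- A treated arc stopped for one of the three reasons in the minimum: no excess left at the tail,
  -- saturation, or a full head.
  stuck : ∀ i v w, 1 ≤ i → j ≤ i → OnLevel E c s t k (i + 1) v → OnLevel E c s t k i w →
    (v, w) ∈ E → (i = j → ¬ rem v w) →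
    Y (i + 1) v = 0 ∨ z (v, w) = c (v, w) ∨ supply E s (a k s) z w = a i w
  -- Either some push out of `v` hit a bound other than its excess, or nothing has left `v`, or
  -- everything has left along one arc.
  single : ∀ i v, 1 ≤ i → OnLevel E c s t k (i + 1) v →
    (∃ w, OnLevel E c s t k i w ∧ (v, w) ∈ E ∧ 0 < c (v, w) ∧ z (v, w) = c (v, w)) ∨
    (∃ w, OnLevel E c s t k i w ∧ supply E s (a k s) z w = a i w) ∨
    outSum E z v = 0 ∨
    (Y (i + 1) v = 0 ∧ ∃ w, (v, w) ∈ E ∧ z (v, w) ≠ 0 ∧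
      z (v, w) = supply E s (a k s) z v)

/-- Moving on to the next level makes all its arcs untreated; they carry no flow because so far flow
has only entered levels above `j`. -/
theorem PushInv.next_level (H : NoShortWalk E c s t k) {j : ℕ} {rem : V → V → Prop}
    {z : V × V → ℝ} {Y : ℕ → V → ℝ}
    (h : PushInv E c s t k a (j + 1) (fun _ _ => False) z Y)
    (hrem : ∀ v w, (v, w) ∈ E → v ≠ t → w ≠ t → rem v w) :
    PushInv E c s t k a j rem z Y where
  __ := h
  Y_zero i v hi hij := h.Y_zero i v hi (by omega)
  z_level e he hz := by
    obtain ⟨i, hi, h'⟩ := h.z_level e he hz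
    exact ⟨i, by omega, h'⟩
  z_rem v w hE _ hv := by
    by_contra hz
    obtain ⟨i, hi, -, h', -⟩ := h.z_level _ hE hz
    have := H.level_unique hv h'
    omega
  stuck i v w hi hij hv hw hE hr := by
    rcases hij.eq_or_lt with rfl | hij
    · exact absurd (hrem v w hE (H.ne_sink hv (by omega)) (H.ne_sink hw hi)) (hr rfl)
    · exact h.stuck i v w hi hij hv hw hE fun _ h => h

/-- Starting at `j = k`, the condition `stuck` is vacuous since there is no level `k + 1`. A nonzero
excess at `s` means `a k s > 0`, which provides the walk that puts `s` on level `k`. -/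
theorem PushInv.init (ha : IsFattest E c t k a) (H : NoShortWalk E c s t k) (hst : s ≠ t)
    (hk : 1 ≤ k) (hc : ∀ e ∈ E, 0 ≤ c e) {z : V × V → ℝ} {Y : ℕ → V → ℝ}
    (hz : ∀ e ∈ E, z e = 0) (hs : Y k s = a k s)
    (hY : ∀ i v, 1 ≤ i → i ≤ k → v ≠ t → (i = k → v ≠ s) → Y i v = 0) :
    PushInv E c s t k a k (fun _ _ => False) z Y := by
  have hout : ∀ v, outSum E z v = 0 := fun v =>
    Finset.sum_eq_zero fun e he => hz e (Finset.mem_filter.1 he).1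
  have hin : ∀ v, inSum E z v = 0 := fun v =>
    Finset.sum_eq_zero fun e he => hz e (Finset.mem_filter.1 he).1
  have hcases : ∀ i v, 1 ≤ i → i ≤ k → v ≠ t → (i = k ∧ v = s) ∨ Y i v = 0 := fun i v h1 h2 h3 =>
    or_iff_not_imp_left.2 fun h => hY i v h1 h2 h3 fun h4 h5 => h ⟨h4, h5⟩
  have hsupply : ∀ i v, 1 ≤ i → OnLevel E c s t k i v → Y i v = supply E s (a k s) z v := by
    intro i v hi hv
    rw [supply, hin, zero_add]
    split_ifs with h
    · subst h
      rw [H.level_unique hv (onLevel_source hv.walk), hs]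
    · exact hY i v hi hv.le (H.ne_sink hv hi) fun _ => h
  refine ⟨?_, ?_, ?_, ?_, ?_, ?_, ?_, ?_, ?_, ?_, ?_, ?_⟩
  · intro i v h1 h2 h3
    rcases hcases i v h1 h2 h3 with ⟨rfl, rfl⟩ | h
    · exact hs ▸ ha.nonneg _ _ h1 h2 h3
    · exact h.ge
  · intro i v h1 h2 h3
    rcases hcases i v h1 h2 h3 with ⟨rfl, rfl⟩ | h
    · exact hs.le
    · exact h ▸ ha.nonneg _ _ h1 h2 h3
  · intro i v h1 h2 h3 h4
    rcases hcases i v h1 h2 h3 with ⟨rfl, rfl⟩ | h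
    · exact onLevel_source (ha.walk h1 h2 h3 ((ha.nonneg _ _ h1 h2 h3).lt_of_ne' (hs ▸ h4)))
    · exact absurd h h4
  · intro i v h1 h2 h3
    exact hY i v h1 h2.le h3 fun h => absurd h h2.ne
  · exact fun e he => (hz e he).ge
  · exact fun e he => (hz e he).le.trans (hc e he)
  · exact fun e he h => absurd (hz e he) h
  · exact fun v w h _ _ => hz _ h
  · intro i v hi hv
    rw [hout, add_zero, hsupply i v hi hv]
  · intro i v hi hv
    rw [← hsupply i v hi hv]
    have h2 := hv.le
    have h3 := H.ne_sink hv hi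
    rcases hcases i v hi h2 h3 with ⟨rfl, rfl⟩ | h
    · exact hs.le
    · exact h ▸ ha.nonneg _ _ hi h2 h3
  · intro i v w _ hi hv
    have := hv.le
    omega
  · exact fun i v _ _ => Or.inr (Or.inr (Or.inl (hout v)))

theorem PushInv.step (ha : IsFattest E c t k a) (H : NoShortWalk E c s t k) {j : ℕ}
    {rem rem' : V → V → Prop} {z : V × V → ℝ} {Y : ℕ → V → ℝ}
    (h : PushInv E c s t k a j rem z Y) {v w : V} (hj : 1 ≤ j) (hjk : j + 1 ≤ k) (hv : v ≠ t)
    (hw : w ≠ t) (hE : (v, w) ∈ E) (hvw : v ≠ w)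
    (hr : rem v w) (hr' : ¬ rem' v w) (hrr' : ∀ v' w', rem' v' w' → rem v' w')
    (hrem : ∀ v' w', rem v' w' → rem' v' w' ∨ v' = v ∧ w' = w) {F : ℝ}
    (hF : F = min (Y (j + 1) v) (min (c (v, w)) (a j w - Y j w))) :
    PushInv E c s t k a j rem' (shiftFlow z v w F) (shiftExcess Y j v w F) := by
  have hYv := h.Y_nonneg (j + 1) v (by omega) hjk hv
  have hYw := h.Y_nonneg j w hj (by omega) hw
  have hcvw : 0 ≤ c (v, w) := (h.z_nonneg _ hE).trans (h.z_le _ hE)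
  have hYaw := h.Y_le j w hj (by omega) hw
  have hF0 : 0 ≤ F := by
    rw [hF]
    exact le_min hYv (le_min hcvw (by linarith))
  have hFY : F ≤ Y (j + 1) v := hF ▸ min_le_left _ _
  have hFc : F ≤ c (v, w) := hF ▸ (min_le_right _ _).trans (min_le_left _ _)
  have hFa : F ≤ a j w - Y j w := hF ▸ (min_le_right _ _).trans (min_le_right _ _)
  have hFcases : F = Y (j + 1) v ∨ F = c (v, w) ∨ F = a j w - Y j w := by
    rcases min_choice (Y (j + 1) v) (min (c (v, w)) (a j w - Y j w)) with h1 | h1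
    · exact Or.inl (hF.trans h1)
    · rcases min_choice (c (v, w)) (a j w - Y j w) with h2 | h2
      · exact Or.inr (Or.inl (hF.trans (h1.trans h2)))
      · exact Or.inr (Or.inr (hF.trans (h1.trans h2)))
  have hzvw : OnLevel E c s t k (j + 1) v → z (v, w) = 0 := h.z_rem v w hE hr
  -- Level `j` has not sent anything yet, so the supply of `w` is just its excess. Hence `F ≤ a j w
  -- - Y j w` is exactly the bound that keeps the supply at most `a j w`.
  have houtw : OnLevel E c s t k j w → outSum E z w = 0 := by
    intro hlw
    refine Finset.sum_eq_zero fun e he => ?_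
    obtain ⟨hmem, rfl⟩ := Finset.mem_filter.1 he
    by_contra hne
    obtain ⟨i, hi, -, h1, -⟩ := h.z_level e hmem hne
    have := H.level_unique hlw h1
    omega
  have hsupw : OnLevel E c s t k j w → supply E s (a k s) z w = Y j w := fun hlw => by
    rw [← h.balance j w hj hlw, houtw hlw, add_zero]
  -- If `F = 0` nothing moves, but the arc becomes treated: the bound attained in the minimum gives
  -- `stuck` for it.
  rcases hF0.eq_or_lt with hF1 | hF1
  · rw [← hF1, shiftFlow_zero, shiftExcess_zero]
    exact {
      __ := h
      z_rem := fun v' w' hE' hr' => h.z_rem v' w' hE' (hrr' v' w' hr')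
      stuck := by
        intro i v' w' hi hij hv' hw' hE' hr1
        by_cases hvw' : i = j ∧ v' = v ∧ w' = w
        · obtain ⟨rfl, rfl, rfl⟩ := hvw'
          rw [hsupw hw', hzvw hv']
          rcases hFcases with h1 | h1 | h1
          · exact Or.inl (by linarith)
          · exact Or.inr (Or.inl (by linarith))
          · exact Or.inr (Or.inr (by linarith))
        · refine h.stuck i v' w' hi hij hv' hw' hE' fun hij' hr2 => ?_
          rcases hrem v' w' hr2 with h1 | h1
          · exact hr1 hij' h1
          · exact hvw' ⟨hij', h1⟩ }
  have hlv : OnLevel E c s t k (j + 1) v :=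
    h.Y_level (j + 1) v (by omega) hjk hv (by linarith)
  -- A positive `F` forces `a j w > 0`, so `t` can be reached from `w` in `j` arcs: the fattest path
  -- values confine the flow to the level network.
  have hlw : OnLevel E c s t k j w := by
    obtain ⟨p, hp, h1, -⟩ := hlv
    exact ⟨p + 1, by omega, h1.snoc ⟨hE, by linarith⟩, ha.walk hj (by omega) hw (by linarith)⟩
  replace hzvw := hzvw hlv
  replace houtw := houtw hlw
  replace hsupw := hsupw hlw
  have uv : ∀ {i}, OnLevel E c s t k i v → i = j + 1 := fun hi => H.level_unique hi hlv
  have uw : ∀ {i}, OnLevel E c s t k i w → i = j := fun hi => H.level_unique hi hlw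
  have hz' : ∀ e, z e ≤ shiftFlow z v w F e := fun e => by
    unfold shiftFlow
    split_ifs <;> linarith
  have hzle : ∀ e ∈ E, shiftFlow z v w F e ≤ c e := fun e he => by
    have := h.z_le e he
    unfold shiftFlow
    split_ifs with h1
    · rw [h1, hzvw]; linarith
    · linarith
  have hsup : ∀ u, supply E s (a k s) z u ≤ supply E s (a k s) (shiftFlow z v w F) u := fun u => by
    rw [supply_shiftFlow hE]
    split_ifs <;> linarith
  have hsuple : ∀ i u, 1 ≤ i → OnLevel E c s t k i u →
      supply E s (a k s) (shiftFlow z v w F) u ≤ a i u := fun i u hi hu => by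
    have := h.supply_le i u hi hu
    rw [supply_shiftFlow hE]
    split_ifs with h1
    · subst h1
      rw [uw hu, hsupw]
      linarith
    · linarith
  have hsat : ∀ e ∈ E, z e = c e → shiftFlow z v w F e = c e := fun e he h1 =>
    (hzle e he).antisymm (h1 ▸ hz' e)
  have hfull : ∀ i u, 1 ≤ i → OnLevel E c s t k i u → supply E s (a k s) z u = a i u →
      supply E s (a k s) (shiftFlow z v w F) u = a i u := fun i u hi hu h1 =>
    (hsuple i u hi hu).antisymm (h1 ▸ hsup u)
  have hYdec : ∀ i u, OnLevel E c s t k i u → u ≠ w → u ≠ t → 1 ≤ i → Y i u = 0 →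
      shiftExcess Y j v w F i u = 0 := fun i u hu huw hut hi h0 => by
    unfold shiftExcess
    rw [if_neg (c := i = j ∧ u = w) (fun h1 => huw h1.2), if_neg, h0]
    · ring
    · rintro ⟨rfl, rfl⟩
      linarith
  refine ⟨?_, ?_, ?_, ?_, ?_, hzle, ?_, ?_, ?_, hsuple, ?_, ?_⟩
  · intro i u h1 h2 h3
    have := h.Y_nonneg i u h1 h2 h3
    unfold shiftExcess
    split_ifs with h4 h5 h5
    · linarith
    · rw [h4.1, h4.2]; linarith
    · linarith
    · linarith
  · intro i u h1 h2 h3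
    have := h.Y_le i u h1 h2 h3
    unfold shiftExcess
    split_ifs with h4 h5 h5
    · linarith
    · linarith
    · rw [h5.1, h5.2]; linarith
    · linarith
  · intro i u h1 h2 h3 h4
    by_cases h5 : i = j + 1 ∧ u = v
    · rw [h5.1, h5.2]; exact hlv
    by_cases h6 : i = j ∧ u = w
    · rw [h6.1, h6.2]; exact hlw
    · simp only [shiftExcess, h5, h6, if_false, sub_zero, add_zero] at h4
      exact h.Y_level i u h1 h2 h3 h4
  · intro i u h1 h2 h3
    have h5 : ¬ (i = j + 1 ∧ u = v) := by omega
    have h6 : ¬ (i = j ∧ u = w) := by omega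
    simp only [shiftExcess, h5, h6, if_false, sub_zero, add_zero]
    exact h.Y_zero i u h1 h2 h3
  · exact fun e he => (h.z_nonneg e he).trans (hz' e)
  · intro e he h1
    by_cases h2 : e = (v, w)
    · subst h2
      exact ⟨j, le_rfl, hj, hlv, hlw⟩
    · simp only [shiftFlow, h2, if_false, add_zero] at h1
      exact h.z_level e he h1
  · intro v' w' hE' hr1 hv'
    have h2 : (v', w') ≠ (v, w) := by
      intro h2
      rw [Prod.mk.injEq] at h2
      exact hr' (h2.1 ▸ h2.2 ▸ hr1)
    simp only [shiftFlow, h2, if_false, add_zero]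
    exact h.z_rem v' w' hE' (hrr' _ _ hr1) hv'
  · intro i u hi hu
    have := h.balance i u hi hu
    rw [outSum_shiftFlow hE, supply_shiftFlow hE]
    unfold shiftExcess
    by_cases h1 : u = v
    · have h2 := uv (h1 ▸ hu)
      have h3 : u ≠ w := h1 ▸ hvw
      simp [h1, h2, hvw]
      rw [h1, h2] at this
      linarith
    · by_cases h3 : u = w
      · have h2 := uw (h3 ▸ hu)
        simp [h3, h2, hvw.symm]
        rw [h3, h2] at this
        linarith
      · simp [h1, h3]
        linarith
  · intro i v' w' hi hij hv' hw' hE' hr1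
    by_cases hvw' : i = j ∧ v' = v ∧ w' = w
    · obtain ⟨rfl, rfl, rfl⟩ := hvw'
      rcases hFcases with h1 | h1 | h1
      · left
        simp [shiftExcess, hvw, h1]
      · right; left
        simp [shiftFlow, hzvw, h1]
      · right; right
        rw [supply_shiftFlow hE, hsupw, if_pos rfl]
        linarith
    · rcases h.stuck i v' w' hi hij hv' hw' hE' (fun hij' hr2 => by
        rcases hrem v' w' hr2 with h1 | h1
        · exact hr1 hij' h1
        · exact hvw' ⟨hij', h1⟩) with h1 | h1 | h1
      · left
        refine hYdec _ _ hv' ?_ (H.ne_sink hv' (by omega)) (by omega) h1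
        rintro rfl
        have := uw hv'
        omega
      · exact Or.inr (Or.inl (hsat _ hE' h1))
      · exact Or.inr (Or.inr (hfull i w' hi hw' h1))
  · intro i v' hi hv'
    rcases h.single i v' hi hv' with ⟨w', h1, h2, h3, h4⟩ | ⟨w', h1, h2⟩ | h1 | ⟨h1, w', h2, h3, h4⟩
    · exact Or.inl ⟨w', h1, h2, h3, hsat _ h2 h4⟩
    · exact Or.inr (Or.inl ⟨w', h1, hfull i w' hi h1 h2⟩)
    -- Nothing had left `v'` before. If `v' = v`, this is its first positive push, and the bound
    -- attained by `F` selects the alternative; when the whole excess moves, it equals the supply of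
    -- `v`.
    · by_cases hv'v : v' = v
      · subst hv'v
        obtain rfl : i = j := by have := uv hv'; omega
        rcases hFcases with h5 | h5 | h5
        · right; right; right
          refine ⟨by simp [shiftExcess, hvw, h5], w, hE, ?_, ?_⟩
          · simp only [shiftFlow, hzvw, if_true, zero_add]
            exact hF1.ne'
          · have := h.balance (i + 1) v' (by omega) hlv
            simp only [shiftFlow, hzvw, if_true, zero_add]
            change _ = supply E s (a k s) (shiftFlow z v' w F) v'
            rw [supply_shiftFlow hE, if_neg hvw]
            linarith
        · exact Or.inl ⟨w, hlw, hE, by linarith, by simp [shiftFlow, hzvw, h5]⟩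
        · refine Or.inr (Or.inl ⟨w, hlw, ?_⟩)
          rw [supply_shiftFlow hE, hsupw, if_pos rfl]
          linarith
      · right; right; left
        rw [outSum_shiftFlow hE, if_neg hv'v, h1, add_zero]
    · have hv'w : v' ≠ w := by
        rintro rfl
        have h5 := le_outSum h.z_nonneg h2
        have h6 := h.z_nonneg _ h2
        exact h3 (by linarith)
      have hne : (v', w') ≠ (v, w) := by
        intro h5
        rw [h5] at h3
        exact h3 hzvw
      refine Or.inr (Or.inr (Or.inr ⟨?_, w', h2, ?_, ?_⟩))
      · exact hYdec _ _ hv' hv'w (H.ne_sink hv' (by omega)) (by omega) h1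
      · simpa [shiftFlow, hne] using h3
      · rw [supply_shiftFlow hE, if_neg hv'w, ← h4]
        simp [shiftFlow, hne]

end Push

/-! ### The saturated arc and the clean-up phase -/

section CleanUp

variable {V : Type*} [LinearOrder V] {E : Finset (V × V)} {c : V × V → ℝ} {s t : V} {k : ℕ}
  {a : ℕ → V → ℝ} {S : ℝ}

/-- The arc `vw` from level `i + 1` to level `i` is saturated, and there is no excess on the
levels up to `i + 1`. -/
structure SaturatedArc (E : Finset (V × V)) (c : V × V → ℝ) (s t : V) (k : ℕ) (z : V × V → ℝ)
    (Y : ℕ → V → ℝ) (i : ℕ) (v w : V) : Prop where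
  mem : (v, w) ∈ E
  level_tail : OnLevel E c s t k (i + 1) v
  level_head : OnLevel E c s t k i w
  pos : 0 < c (v, w)
  eq : z (v, w) = c (v, w)
  Y_zero : ∀ l u, 1 ≤ l → l ≤ i + 1 → u ≠ t → Y l u = 0

/-- The invariant of the clean-up phase while excess on level `j` is returned and the arcs in
`rem` are still to be treated. -/
structure CleanUpInv (E : Finset (V × V)) (c : V × V → ℝ) (s t : V) (k : ℕ) (S : ℝ) (j : ℕ)
    (rem : V → V → Prop) (z : V × V → ℝ) (Y : ℕ → V → ℝ) : Prop where
  Y_nonneg : ∀ i v, 1 ≤ i → i ≤ k → v ≠ t → 0 ≤ Y i v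
  Y_level : ∀ i v, 1 ≤ i → i ≤ k → v ≠ t → Y i v ≠ 0 → OnLevel E c s t k i v
  Y_zero : ∀ i v, 1 ≤ i → i < j → i ≤ k → v ≠ t → Y i v = 0
  z_nonneg : ∀ e ∈ E, 0 ≤ z e
  z_le : ∀ e ∈ E, z e ≤ c e
  z_level : ∀ e ∈ E, z e ≠ 0 → ∃ i, OnLevel E c s t k (i + 1) e.1 ∧ OnLevel E c s t k i e.2
  balance : ∀ i v, 1 ≤ i → OnLevel E c s t k i v → Y i v + outSum E z v = supply E s S z v
  cleared : ∀ v w, (v, w) ∈ E → v ≠ t → w ≠ t → ¬ rem v w → Y j w = 0 ∨ z (v, w) = 0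
  saturated : WalkOfLength (ResidualArc E c) k s t → ∃ i v w, SaturatedArc E c s t k z Y i v w

/-- Properties of the flow that is found by the subroutine. -/
structure IsAugmentation (E : Finset (V × V)) (c : V × V → ℝ) (s t : V) (k : ℕ)
    (z : V × V → ℝ) : Prop where
  nonneg : ∀ e ∈ E, 0 ≤ z e
  le : ∀ e ∈ E, z e ≤ c e
  level : ∀ e ∈ E, z e ≠ 0 → ∃ i, OnLevel E c s t k (i + 1) e.1 ∧ OnLevel E c s t k i e.2
  conservation : ∀ v, v ≠ s → v ≠ t → netOutflow E z v = 0
  saturated : WalkOfLength (ResidualArc E c) k s t → ∃ e ∈ E, 0 < c e ∧ z e = c e ∧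
    ∃ i, OnLevel E c s t k (i + 1) e.1 ∧ OnLevel E c s t k i e.2

/-- After the pushing phase there is a saturated arc below which no excess is left. -/
theorem PushInv.exists_saturatedArc (ha : IsFattest E c t k a) (H : NoShortWalk E c s t k)
    (hst : s ≠ t) (hk : 1 ≤ k) {z z' : V × V → ℝ} {Y Y' : ℕ → V → ℝ}
    (h : PushInv E c s t k a 1 (fun _ _ => False) z Y)
    (hz1 : ∀ v, (v, t) ∈ E → z' (v, t) = Y 1 v) (hz2 : ∀ e ∈ E, e.2 ≠ t → z' e = z e)
    (hY1 : ∀ v, v ≠ t → Y' 1 v = 0)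
    (hY2 : ∀ i v, 2 ≤ i → i ≤ k → v ≠ t → Y' i v = Y i v)
    (hwalk : WalkOfLength (ResidualArc E c) k s t) :
    ∃ i v w, SaturatedArc E c s t k z' Y' i v w := by
  have hin : ∀ v, 0 ≤ inSum E z v := fun v =>
    Finset.sum_nonneg fun e he => h.z_nonneg e (Finset.mem_filter.1 he).1
  have hsupply : ∀ v, inSum E z v ≤ supply E s (a k s) z v := fun v => by
    have := ha.nonneg k s hk le_rfl hst
    unfold supply
    split_ifs <;> linarith
  classical
  -- The source is full, being supplied with `a k s`; so a lowest level with a full node exists.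
  have hex : ∃ i, 1 ≤ i ∧ ∃ v, OnLevel E c s t k i v ∧ supply E s (a k s) z v = a i v := by
    refine ⟨k, hk, s, onLevel_source hwalk, ?_⟩
    refine (h.supply_le k s hk (onLevel_source hwalk)).antisymm ?_
    have := hin s
    rw [supply, if_pos rfl]
    linarith
  obtain ⟨hi1, v, hv, hfull⟩ := Nat.find_spec hex
  have hmin : ∀ i w, 1 ≤ i → i < Nat.find hex → OnLevel E c s t k i w →
      supply E s (a k s) z w ≠ a i w := fun i w h1 h2 h3 h4 => Nat.find_min hex h2 ⟨h1, w, h3, h4⟩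
  generalize Nat.find hex = i₀ at *
  have hzero : ∀ l u, 1 ≤ l → l ≤ i₀ → u ≠ t → Y' l u = 0 := by
    intro l u hl hli hu
    have hlk : l ≤ k := hli.trans hv.le
    rcases hl.eq_or_lt with rfl | hl
    · exact hY1 u hu
    obtain ⟨p, rfl⟩ : ∃ p, l = p + 1 := ⟨l - 1, by omega⟩
    rw [hY2 _ u hl hlk hu]
    by_contra hne
    have hlu := h.Y_level (p + 1) u (by omega) hlk hu hne
    -- Excess left at `u` is refuted on the arc `uw` that attains its fattest value. Saturation
    -- would give `z (u, w) = c (u, w) ≥ a (p + 1) u`, at least the supply of `u`, leaving no room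
    -- for excess.
    obtain ⟨w, hw, hE, hle⟩ := ha.exists_le p u (by omega) hlk hu (ha.pos H (by omega) hlu)
    have hpos := lt_min_iff.1 ((ha.pos H (by omega) hlu).trans_le hle)
    have hlw : OnLevel E c s t k p w := by
      obtain ⟨q, hq, h1, -⟩ := hlu
      exact ⟨q + 1, by omega, h1.snoc ⟨hE, hpos.2⟩, ha.walk (by omega) (by omega) hw hpos.1⟩
    rcases h.stuck p u w (by omega) (by omega) hlu hlw hE (fun _ h => h) with h1 | h1 | h1
    · exact hne h1
    · have h2 := h.balance (p + 1) u (by omega) hlu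
      have h3 := h.supply_le (p + 1) u (by omega) hlu
      have h4 := le_outSum h.z_nonneg hE
      have h5 := (h.Y_nonneg (p + 1) u (by omega) hlk hu).lt_of_ne' hne
      have h6 := hle.trans (min_le_right _ _)
      linarith
    · exact hmin p w (by omega) (by omega) hlw h1
  rcases hi1.eq_or_lt with rfl | hi1
  · have hE : (v, t) ∈ E ∧ 0 < c (v, t) := by
      obtain ⟨-, -, -, w, hw, rfl⟩ := hv
      exact hw
    have hout : outSum E z v = 0 := by
      refine Finset.sum_eq_zero fun e he => ?_
      obtain ⟨hmem, rfl⟩ := Finset.mem_filter.1 he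
      by_contra hne
      obtain ⟨i, -, hi, h1, -⟩ := h.z_level e hmem hne
      have := H.level_unique hv h1
      omega
    refine ⟨0, v, t, hE.1, hv, ⟨k, Nat.add_zero k, hwalk, rfl⟩, hE.2, ?_, hzero⟩
    rw [hz1 v hE.1, ← ha.one_of_mem v hE.1, ← hfull, ← h.balance 1 v le_rfl hv, hout, add_zero]
  · obtain ⟨p, rfl⟩ : ∃ p, i₀ = p + 1 := ⟨i₀ - 1, by omega⟩
    have hpk := hv.le
    have hvt := H.ne_sink hv (by omega)
    have hapos := ha.pos H (by omega) hv
    have hsat : ∀ w, OnLevel E c s t k p w → (v, w) ∈ E → 0 < c (v, w) → z (v, w) = c (v, w) →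
        ∃ i v w, SaturatedArc E c s t k z' Y' i v w := fun w hw hE hpos heq =>
      ⟨p, v, w, hE, hv, hw, hpos, (hz2 _ hE (H.ne_sink hw (by omega))).trans heq, hzero⟩
    rcases h.single p v (by omega) hv with ⟨w, hw, hE, hpos, heq⟩ | ⟨w, hw, heq⟩ | hout |
      ⟨-, w, hE, hne, heq⟩
    · exact hsat w hw hE hpos heq
    · exact absurd heq (hmin p w (by omega) (by omega) hw)
    · have h1 := h.balance (p + 1) v (by omega) hv
      rw [← hY2 (p + 1) v (by omega) hpk hvt, hzero (p + 1) v (by omega) le_rfl hvt] at h1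
      linarith
    · obtain ⟨i, -, hi, h1, hw⟩ := h.z_level _ hE hne
      obtain rfl : p = i := by
        have := H.level_unique hv h1
        omega
      have h2 := h.z_le _ hE
      have h3 := (h.z_nonneg _ hE).lt_of_ne' hne
      rcases h2.eq_or_lt with h4 | h4
      · exact hsat w hw hE (h4 ▸ h3) h4
      -- The whole supply `a (p + 1) v` went through the unsaturated arc `vw`. As it is at least
      -- `min (a p w) (c (v, w))`, the flow is at least `a p w`, so `w` is full on a lower level.
      · exfalso
        refine hmin p w hi (by omega) hw ((h.supply_le p w hi hw).antisymm ?_)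
        have h5 := ha.le p v w hi hpk hvt (H.ne_sink hw hi) hE
        have h6 := le_inSum h.z_nonneg hE
        have h7 := hsupply w
        rcases min_le_iff.1 h5 with h8 | h8 <;> linarith

/-- Sending the excess of level `1` to `t` finishes the pushing phase. -/
theorem PushInv.cleanUpInv (ha : IsFattest E c t k a) (H : NoShortWalk E c s t k)
    (hloop : ∀ v, (v, v) ∉ E) (hst : s ≠ t) (hk : 1 ≤ k) {z z' : V × V → ℝ} {Y Y' : ℕ → V → ℝ}
    {rem : V → V → Prop} (h : PushInv E c s t k a 1 (fun _ _ => False) z Y)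
    (hz1 : ∀ v, (v, t) ∈ E → z' (v, t) = Y 1 v) (hz2 : ∀ e ∈ E, e.2 ≠ t → z' e = z e)
    (hY1 : ∀ v, (v, t) ∈ E → Y' 1 v = 0)
    (hY2 : ∀ i v, 1 ≤ i → i ≤ k → v ≠ t → (i = 1 → (v, t) ∉ E) → Y' i v = Y i v)
    (hrem : ∀ v w, (v, w) ∈ E → v ≠ t → w ≠ t → rem v w) :
    CleanUpInv E c s t k (a k s) 2 rem z' Y' := by
  have hY10 : ∀ v, v ≠ t → (v, t) ∉ E → Y 1 v = 0 := fun v hv hE =>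
    ((h.Y_le 1 v le_rfl hk hv).trans (ha.one_of_notMem v hv hE).le).antisymm
      (h.Y_nonneg 1 v le_rfl hk hv)
  have hY'1 : ∀ v, v ≠ t → Y' 1 v = 0 := fun v hv => by
    by_cases hE : (v, t) ∈ E
    · exact hY1 v hE
    · rw [hY2 1 v le_rfl hk hv fun _ => hE, hY10 v hv hE]
  have hY'2 : ∀ i v, 2 ≤ i → i ≤ k → v ≠ t → Y' i v = Y i v := fun i v h1 h2 h3 =>
    hY2 i v (by omega) h2 h3 (by omega)
  have htail : ∀ {v}, (v, t) ∈ E → v ≠ t := by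
    rintro v hE rfl
    exact hloop _ hE
  have hzt : ∀ v, (v, t) ∈ E → z (v, t) = 0 := fun v hE => by
    by_contra hne
    obtain ⟨i, -, hi, -, h1⟩ := h.z_level _ hE hne
    exact H.ne_sink h1 hi rfl
  have hout : ∀ v, v ≠ t → outSum E z' v = outSum E z v + Y 1 v := by
    intro v hv
    have h1 : outSum E z' v = ∑ e ∈ E with e.1 = v, (z e + if e = (v, t) then Y 1 v else 0) := by
      refine Finset.sum_congr rfl fun e he => ?_
      obtain ⟨hmem, rfl⟩ := Finset.mem_filter.1 he
      obtain ⟨u, w⟩ := e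
      by_cases hw : w = t
      · subst hw
        simp [hz1 u hmem, hzt u hmem]
      · simp [hw, hz2 _ hmem]
    rw [h1, Finset.sum_add_distrib, Finset.sum_ite_eq', outSum]
    split_ifs with hE
    · rfl
    · rw [hY10 v hv fun hE' => hE (Finset.mem_filter.2 ⟨hE', rfl⟩)]
  have hin : ∀ v, v ≠ t → inSum E z' v = inSum E z v := fun v hv =>
    Finset.sum_congr rfl fun e he => by
      obtain ⟨hmem, rfl⟩ := Finset.mem_filter.1 he
      exact hz2 e hmem hv
  refine ⟨?_, ?_, ?_, ?_, ?_, ?_, ?_, ?_, ?_⟩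
  · intro i v h1 h2 h3
    rcases h1.eq_or_lt with rfl | h1
    · exact (hY'1 v h3).ge
    · rw [hY'2 i v h1 h2 h3]
      exact h.Y_nonneg i v (by omega) h2 h3
  · intro i v h1 h2 h3 h4
    rcases h1.eq_or_lt with rfl | h1
    · exact absurd (hY'1 v h3) h4
    · rw [hY'2 i v h1 h2 h3] at h4
      exact h.Y_level i v (by omega) h2 h3 h4
  · intro i v h1 h2 _ h3
    obtain rfl : i = 1 := by omega
    exact hY'1 v h3
  · rintro ⟨v, w⟩ he
    by_cases hw : w = t
    · subst hw
      rw [hz1 v he]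
      exact h.Y_nonneg 1 v le_rfl hk (htail he)
    · rw [hz2 _ he hw]
      exact h.z_nonneg _ he
  · rintro ⟨v, w⟩ he
    by_cases hw : w = t
    · subst hw
      rw [hz1 v he, ← ha.one_of_mem v he]
      exact h.Y_le 1 v le_rfl hk (htail he)
    · rw [hz2 _ he hw]
      exact h.z_le _ he
  · rintro ⟨v, w⟩ he hne
    by_cases hw : w = t
    · subst hw
      rw [hz1 v he] at hne
      have hv := h.Y_level 1 v le_rfl hk (htail he) hne
      exact ⟨0, hv, k, Nat.add_zero k, hv.walk, rfl⟩
    · rw [hz2 _ he hw] at hne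
      obtain ⟨i, -, -, h1⟩ := h.z_level _ he hne
      exact ⟨i, h1⟩
  · intro i v hi hv
    have hvt := H.ne_sink hv hi
    have h1 := h.balance i v hi hv
    unfold supply at h1 ⊢
    rw [hout v hvt, hin v hvt]
    rcases hi.eq_or_lt with rfl | hi
    · rw [hY'1 v hvt]
      linarith
    · rw [hY'2 i v hi hv.le hvt]
      -- Only nodes of level `1` have excess indexed by `1`; on higher levels the added outflow
      -- vanishes.
      have h2 : Y 1 v = 0 := by
        by_contra hne
        have := H.level_unique hv (h.Y_level 1 v le_rfl hk hvt hne)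
        omega
      linarith
  · exact fun v w hE hv hw hr => absurd (hrem v w hE hv hw) hr
  · exact h.exists_saturatedArc ha H hst hk hz1 hz2 hY'1 hY'2

/-- Returning `b` is a push of `-b`. With `b > 0` both ends of the arc lie on the expected levels,
since they carry excess and flow. -/
theorem CleanUpInv.step (H : NoShortWalk E c s t k) {j : ℕ}
    {rem rem' : V → V → Prop} {z : V × V → ℝ} {Y : ℕ → V → ℝ}
    (h : CleanUpInv E c s t k S j rem z Y) {v w : V} (hj : 1 ≤ j) (hjk : j + 1 ≤ k) (hv : v ≠ t)
    (hw : w ≠ t) (hE : (v, w) ∈ E) (hvw : v ≠ w)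
    (hrem : ∀ v' w', rem v' w' → rem' v' w' ∨ v' = v ∧ w' = w) {b : ℝ}
    (hb : b = min (Y j w) (z (v, w))) :
    CleanUpInv E c s t k S j rem' (shiftFlow z v w (-b)) (shiftExcess Y j v w (-b)) := by
  have hYw := h.Y_nonneg j w hj (by omega) hw
  have hzvw := h.z_nonneg _ hE
  have hb0 : 0 ≤ b := hb ▸ le_min hYw hzvw
  have hbY : b ≤ Y j w := hb ▸ min_le_left _ _
  have hbz : b ≤ z (v, w) := hb ▸ min_le_right _ _
  have hbcases : b = Y j w ∨ b = z (v, w) := by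
    rcases min_choice (Y j w) (z (v, w)) with h1 | h1
    · exact Or.inl (hb.trans h1)
    · exact Or.inr (hb.trans h1)
  rcases hb0.eq_or_lt with hb1 | hb1
  · rw [← hb1, neg_zero, shiftFlow_zero, shiftExcess_zero]
    exact {
      __ := h
      cleared := by
        intro v' w' hE' hv' hw' hr
        by_cases hvw' : v' = v ∧ w' = w
        · obtain ⟨rfl, rfl⟩ := hvw'
          rcases hbcases with h1 | h1
          · exact Or.inl (by linarith)
          · exact Or.inr (by linarith)
        · refine h.cleared v' w' hE' hv' hw' fun hr' => ?_
          rcases hrem v' w' hr' with h1 | h1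
          · exact hr h1
          · exact hvw' h1 }
  have hlw : OnLevel E c s t k j w := h.Y_level j w hj (by omega) hw (by linarith)
  have hlv : OnLevel E c s t k (j + 1) v := by
    obtain ⟨i, h1, h2⟩ := h.z_level _ hE (by linarith)
    obtain rfl := H.level_unique hlw h2
    exact h1
  have hznn : ∀ e ∈ E, 0 ≤ shiftFlow z v w (-b) e := fun e he => by
    have := h.z_nonneg e he
    unfold shiftFlow
    split_ifs with h1
    · rw [h1]; linarith
    · linarith
  have hzle : ∀ e, shiftFlow z v w (-b) e ≤ z e := fun e => by
    unfold shiftFlow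
    split_ifs <;> linarith
  have hYsame : ∀ i u, ¬ (i = j + 1 ∧ u = v) → ¬ (i = j ∧ u = w) →
      shiftExcess Y j v w (-b) i u = Y i u := fun i u h1 h2 => by
    simp [shiftExcess, h1, h2]
  refine ⟨?_, ?_, ?_, hznn, ?_, ?_, ?_, ?_, ?_⟩
  · intro i u h1 h2 h3
    have := h.Y_nonneg i u h1 h2 h3
    unfold shiftExcess
    split_ifs with h4 h5 h5
    · linarith
    · linarith
    · rw [h5.1, h5.2]; linarith
    · linarith
  · intro i u h1 h2 h3 h4
    by_cases h5 : i = j + 1 ∧ u = v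
    · rw [h5.1, h5.2]; exact hlv
    by_cases h6 : i = j ∧ u = w
    · rw [h6.1, h6.2]; exact hlw
    · rw [hYsame i u h5 h6] at h4
      exact h.Y_level i u h1 h2 h3 h4
  · intro i u h1 h2 h3 h4
    rw [hYsame i u (by omega) (by omega)]
    exact h.Y_zero i u h1 h2 h3 h4
  · exact fun e he => (hzle e).trans (h.z_le e he)
  · intro e he hne
    refine h.z_level e he fun h0 => hne ?_
    exact ((hzle e).trans h0.le).antisymm (hznn e he)
  · intro i u hi hu
    have := h.balance i u hi hu
    rw [outSum_shiftFlow hE, supply_shiftFlow hE]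
    unfold shiftExcess
    by_cases h1 : u = v
    · have h2 := H.level_unique (h1 ▸ hu) hlv
      simp [h1, h2, hvw]
      rw [h1, h2] at this
      linarith
    · by_cases h3 : u = w
      · have h2 := H.level_unique (h3 ▸ hu) hlw
        simp [h3, h2, hvw.symm]
        rw [h3, h2] at this
        linarith
      · simp [h1, h3]
        linarith
  · intro v' w' hE' hv' hw' hr
    by_cases hvw' : v' = v ∧ w' = w
    · obtain ⟨rfl, rfl⟩ := hvw'
      rcases hbcases with h1 | h1
      · left
        simp [shiftExcess, h1]
      · right
        simp [shiftFlow, h1]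
    · rcases h.cleared v' w' hE' hv' hw' (fun hr' => by
        rcases hrem v' w' hr' with h1 | h1
        · exact hr h1
        · exact hvw' h1) with h1 | h1
      · left
        rw [hYsame j w' (by omega), h1]
        rintro ⟨-, rfl⟩
        linarith
      · exact Or.inr (((hzle _).trans h1.le).antisymm (hznn _ hE'))
  · intro hwalk
    obtain ⟨i, v', w', h'⟩ := h.saturated hwalk
    -- There is excess on level `j`, whereas none is left up to the tail of the saturated arc; so
    -- the step acts strictly above it.
    have hij : i + 1 < j := by
      by_contra hij
      have := h'.Y_zero j w hj (by omega) hw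
      linarith
    refine ⟨i, v', w', { h' with eq := ?_, Y_zero := ?_ }⟩
    · have hne : (v', w') ≠ (v, w) := by
        intro h1
        rw [Prod.mk.injEq] at h1
        have := H.level_unique hlw (h1.2 ▸ h'.level_head)
        omega
      simp [shiftFlow, hne, h'.eq]
    · intro l u h1 h2 h3
      rw [hYsame l u (by omega) (by omega)]
      exact h'.Y_zero l u h1 h2 h3

/-- Excess surviving at a node would mean that all its incoming arcs were emptied. But below level
`k` the node is not `s`, and its excess is at most its inflow. -/
theorem CleanUpInv.next_level (H : NoShortWalk E c s t k) {j : ℕ} (hj : 1 ≤ j) (hjk : j < k)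
    {rem : V → V → Prop} {z : V × V → ℝ} {Y : ℕ → V → ℝ}
    (h : CleanUpInv E c s t k S j (fun _ _ => False) z Y)
    (hrem : ∀ v w, (v, w) ∈ E → v ≠ t → w ≠ t → rem v w) :
    CleanUpInv E c s t k S (j + 1) rem z Y where
  __ := h
  cleared v w hE hv hw hr := absurd (hrem v w hE hv hw) hr
  Y_zero i w hi hij hik hw := by
    rcases (Nat.lt_succ_iff.1 hij).eq_or_lt with rfl | hij
    · by_contra hne
      have hlw := h.Y_level i w hi hik hw hne
      have hin : inSum E z w = 0 := by
        refine Finset.sum_eq_zero fun e he => ?_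
        obtain ⟨hmem, rfl⟩ := Finset.mem_filter.1 he
        by_contra hze
        have htail : e.1 ≠ t := by
          obtain ⟨p, h1, -⟩ := h.z_level e hmem hze
          exact H.ne_sink h1 (by omega)
        rcases h.cleared e.1 e.2 hmem htail hw (fun h => h) with h1 | h1
        · exact hne h1
        · exact hze h1
      have h1 := h.balance i w hi hlw
      rw [supply, hin, if_neg (H.ne_source hlw hjk)] at h1
      have h2 : 0 ≤ outSum E z w :=
        Finset.sum_nonneg fun e he => h.z_nonneg e (Finset.mem_filter.1 he).1
      have h3 := (h.Y_nonneg i w hi hik hw).lt_of_ne' hne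
      linarith
    · exact h.Y_zero i w hi hij hik hw

/-- Levels `0` and `k` contain only `t` and `s`; the levels between have no excess, and nodes off
all levels carry no flow. Excess may remain at `s`, where conservation is not required. -/
theorem CleanUpInv.isAugmentation (H : NoShortWalk E c s t k) {j : ℕ} (hjk : k ≤ j)
    {rem : V → V → Prop} {z : V × V → ℝ} {Y : ℕ → V → ℝ}
    (h : CleanUpInv E c s t k S j rem z Y) : IsAugmentation E c s t k z where
  nonneg := h.z_nonneg
  le := h.z_le
  level := h.z_level
  conservation v hvs hvt := by
    rw [netOutflow_eq]
    by_cases hv : ∃ i, OnLevel E c s t k i v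
    · obtain ⟨i, hi⟩ := hv
      have hi0 : i ≠ 0 := by
        rintro rfl
        exact hvt hi.eq_sink
      have hik : i ≠ k := by
        rintro rfl
        exact hvs hi.eq_source
      have hik' := hi.le
      have h1 := h.balance i v (by omega) hi
      rw [h.Y_zero i v (by omega) (by omega) hik' hvt, supply, if_neg hvs] at h1
      linarith
    · have h1 : outSum E z v = 0 := by
        refine Finset.sum_eq_zero fun e he => ?_
        obtain ⟨hmem, rfl⟩ := Finset.mem_filter.1 he
        by_contra hne
        obtain ⟨i, h1, -⟩ := h.z_level e hmem hne
        exact hv ⟨_, h1⟩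
      have h2 : inSum E z v = 0 := by
        refine Finset.sum_eq_zero fun e he => ?_
        obtain ⟨hmem, rfl⟩ := Finset.mem_filter.1 he
        by_contra hne
        obtain ⟨i, -, h1⟩ := h.z_level e hmem hne
        exact hv ⟨_, h1⟩
      rw [h1, h2, sub_zero]
  saturated hwalk := by
    obtain ⟨i, v, w, h'⟩ := h.saturated hwalk
    exact ⟨(v, w), h'.mem, h'.pos, h'.eq, i, h'.level_tail, h'.level_head⟩

end CleanUp

/-! ### Progress made by one augmentation -/

section Augmentation

variable {V : Type*} [LinearOrder V] {E : Finset (V × V)} {c c' : V × V → ℝ} {s t : V} {k : ℕ}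
  {z : V × V → ℝ}

theorem IsAugmentation.isLevelUpdate (h : IsAugmentation E c s t k z)
    (hsymm : ∀ u v, (u, v) ∈ E → (v, u) ∈ E)
    (hc' : ∀ e ∈ E, c' e = c e - z e + z e.swap) : IsLevelUpdate E c c' s t k := by
  rintro u v ⟨hE, hpos⟩
  by_cases hc : 0 < c (u, v)
  · exact Or.inl ⟨hE, hc⟩
  · rw [hc' _ hE] at hpos
    have h1 := h.nonneg _ hE
    obtain ⟨i, h2⟩ := h.level (v, u) (hsymm _ _ hE) (by
      simp only [Prod.swap_prod_mk] at hpos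
      intro h2
      linarith)
    exact Or.inr ⟨i, h2⟩

/-- The saturated arc disappears: its reverse carries no flow, since flow only descends levels, so
its new residual capacity is zero. -/
theorem IsAugmentation.levelArcs_ssubset (h : IsAugmentation E c s t k z)
    (hsymm : ∀ u v, (u, v) ∈ E → (v, u) ∈ E) (H : NoShortWalk E c s t k)
    (hc' : ∀ e ∈ E, c' e = c e - z e + z e.swap)
    (hwalk : WalkOfLength (ResidualArc E c) k s t) :
    levelArcs E c' s t k ⊂ levelArcs E c s t k := by
  refine ((h.isLevelUpdate hsymm hc').levelArcs_subset H).ssubset_of_not_subset fun hsub => ?_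
  obtain ⟨e, he, hpos, heq, i, h1, h2⟩ := h.saturated hwalk
  have hmem : e ∈ levelArcs E c s t k := by
    simp only [levelArcs, Finset.mem_filter]
    exact ⟨he, hpos, i, h1, h2⟩
  have hmem' := hsub hmem
  simp only [levelArcs, Finset.mem_filter] at hmem'
  have hswap : z e.swap = 0 := by
    by_contra hne
    obtain ⟨i', h3, h4⟩ := h.level e.swap (hsymm _ _ he) hne
    have := H.level_unique h1 h4
    have := H.level_unique h2 h3
    omega
  have := hmem'.2.1
  rw [hc' e he, heq, hswap] at this
  linarith

omit [LinearOrder V] in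
/-- If there are no arcs between consecutive levels, there is no residual walk with `k` arcs. -/
theorem NoShortWalk.of_card_levelArcs_eq_zero (hk : 1 ≤ k) (H : NoShortWalk E c s t k)
    (h : (levelArcs E c s t k).card = 0) : NoShortWalk E c s t (k + 1) := by
  intro i hi hw
  rcases (Nat.lt_succ_iff.1 hi).eq_or_lt with rfl | hi
  · exact (levelArcs_nonempty hk hw).ne_empty (Finset.card_eq_zero.1 h)
  · exact H i hi hw

end Augmentation

/-! ### Semantics of the program: well-formedness, initialization, fattest path values -/

section Program

variable {V : Type*} [Fintype V] [LinearOrder V] {E : Finset (V × V)} {c : V × V → ℝ} {s t : V}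
  {k : ℕ} {a : ℕ → V → ℝ}

open MAAP FlowVar

@[simp] theorem mem_nodesWithout {v : V} : v ∈ nodesWithout t ↔ v ≠ t := by
  simp [nodesWithout]

@[simp] theorem mem_succWithout {v w : V} : w ∈ succWithout E t v ↔ (v, w) ∈ E ∧ w ≠ t := by
  simp [succWithout]

@[simp] theorem mem_predWithout {v w : V} : v ∈ predWithout E t w ↔ (v, w) ∈ E ∧ v ≠ t := by
  simp [predWithout]

@[simp] theorem mem_predSink {v : V} : v ∈ predSink E t ↔ (v, t) ∈ E := by
  simp [predSink]

omit [Fintype V] in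
@[simp] theorem mem_forwardArcs {e : V × V} : e ∈ forwardArcs E ↔ e ∈ E ∧ e.1 < e.2 := by
  simp [forwardArcs]

theorem nodup_nodesWithout : (nodesWithout t).Nodup := Finset.sort_nodup _ _

theorem nodup_succWithout (v : V) : (succWithout E t v).Nodup := Finset.sort_nodup _ _

theorem nodup_predWithout (v : V) : (predWithout E t v).Nodup := Finset.sort_nodup _ _

theorem nodup_predSink : (predSink E t).Nodup := Finset.sort_nodup _ _

/-! #### The program is well-formed -/

theorem wellFormed_findInit : (findInit E t k).WellFormed := by
  refine wellFormed_block ?_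
  simp only [List.mem_cons, List.not_mem_nil, or_false, forall_eq_or_imp, forall_eq]
  refine ⟨wellFormed_forPar (Finset.nodup_toList _) (fun e he => ?_) ?_,
    wellFormed_forPar (List.nodup_range' ) (fun i hi =>
      wellFormed_forPar nodup_nodesWithout (fun v hv => ?_) ?_) ?_⟩
  · simp [WellFormed, MAAP.set]
  · rintro ⟨u, v⟩ he ⟨u', v'⟩ he' hne x hx
    simp [assigned, vars, MAAP.set, MaxAffine.vars, MaxAffine.parts, Affine.num] at *
    grind
  · simp [WellFormed, MAAP.set]
  · intro v hv w hw hne x hx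
    simp [assigned, vars, MAAP.set, MaxAffine.vars, MaxAffine.parts, Affine.num] at *
    grind
  · intro i hi j hj hne x hx
    simp [assigned, vars, MAAP.set, MaxAffine.vars, MaxAffine.parts, Affine.num] at *
    grind

theorem wellFormed_findFattest : (findFattest E t k).WellFormed := by
  refine wellFormed_block ?_
  simp only [List.mem_cons, List.not_mem_nil, or_false, forall_eq_or_imp, forall_eq]
  refine ⟨wellFormed_forPar nodup_predSink (fun e he => ?_) ?_,
    wellFormed_forDo fun i hi => wellFormed_forPar nodup_nodesWithout (fun v hv => ?_) ?_⟩
  · simp [WellFormed, MAAP.set]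
  · intro v hv w hw hne x hx
    simp [assigned, vars, MAAP.set, MaxAffine.vars, MaxAffine.parts, Affine.var] at *
    grind
  · refine ⟨wellFormed_forPar (nodup_succWithout v) (fun w hw => ?_) ?_, wellFormed_setMax _ _,
      trivial⟩
    · simp [WellFormed, MAAP.setMin]
    · intro v hv w hw hne x hx
      simp [assigned, vars, MAAP.setMin, MaxAffine.vars, MaxAffine.parts, Affine.var] at *
      grind
  · intro v hv w hw hne x hx
    simp [assigned, vars, MAAP.setMin, MaxAffine.vars, MaxAffine.parts, Affine.var] at *
    grind

theorem wellFormed_findPush : (findPush E s t k).WellFormed := by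
  refine wellFormed_block ?_
  simp only [List.mem_cons, List.not_mem_nil, or_false, forall_eq_or_imp, forall_eq]
  refine ⟨trivial, wellFormed_forDo fun i hi => wellFormed_forDo fun v hv =>
    wellFormed_forDo fun w hw => ?_, wellFormed_forPar nodup_predSink (fun e he => ?_) ?_⟩
  · simp [WellFormed, MAAP.set, MAAP.setMin]
  · simp [WellFormed, MAAP.set]
  · intro v hv w hw hne x hx
    simp [assigned, vars, MAAP.set, MaxAffine.vars, MaxAffine.parts, Affine.var,
      Affine.num] at *
    grind

theorem wellFormed_findCleanUp : (findCleanUp E t k).WellFormed := by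
  refine wellFormed_forDo fun i hi => wellFormed_forDo fun v hv => wellFormed_forDo fun w hw => ?_
  simp [WellFormed, MAAP.set, MAAP.setMin]

theorem wellFormed_findAugmentingFlow : (findAugmentingFlow E s t k).WellFormed := by
  refine wellFormed_block ?_
  simp only [List.mem_cons, List.not_mem_nil, or_false, forall_eq_or_imp, forall_eq]
  refine ⟨wellFormed_findInit, wellFormed_findFattest, wellFormed_findPush,
    wellFormed_findCleanUp, wellFormed_forPar (Finset.nodup_toList _) (fun e he => trivial) ?_⟩
  rintro ⟨u, v⟩ he ⟨u', v'⟩ he' hne x hx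
  simp [assigned, vars, MAAP.set, MaxAffine.vars, MaxAffine.parts, Affine.sub] at *
  grind

theorem wellFormed_maxFlowRounds (r : ℕ) : (maxFlowRounds E s t r).WellFormed := by
  refine wellFormed_block ?_
  simp only [List.mem_cons, List.not_mem_nil, or_false, forall_eq_or_imp, forall_eq]
  refine ⟨wellFormed_forPar (Finset.nodup_toList _) (fun e he => ?_) ?_,
    wellFormed_forDo fun i hi => wellFormed_forDo fun v hv => ⟨wellFormed_findAugmentingFlow,
      wellFormed_forPar (Finset.nodup_toList _) (fun e he => ?_) ?_, trivial⟩⟩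
  · simp [WellFormed, MAAP.set]
  · rintro ⟨u, v⟩ he ⟨u', v'⟩ he' hne x hx
    simp [assigned, vars, MAAP.set, MaxAffine.vars, MaxAffine.parts, Affine.num,
      Affine.var] at *
    grind
  · simp [WellFormed, MAAP.set]
  · rintro ⟨u, v⟩ he ⟨u', v'⟩ he' hne x hx
    simp [assigned, vars, MAAP.set, MaxAffine.vars, MaxAffine.parts, Affine.sub,
      Affine.add] at *
    grind

/-! #### Initialization -/

theorem findInit_z (hloop : ∀ v, (v, v) ∉ E) (hsymm : ∀ u v, (u, v) ∈ E → (v, u) ∈ E)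
    (σ : FlowVar V → ℝ) {u v : V} (h : (u, v) ∈ E) : (findInit E t k).run σ (z u v) = 0 := by
  simp only [findInit, block_cons, block_nil, run]
  rw [run_of_notMem_assigned _ (by simp [assigned, MAAP.set])]
  rcases lt_trichotomy u v with huv | rfl | huv
  · rw [run_forPar_of_mem (i := (u, v)) (by simp [h, huv]) (by simp [assigned, MAAP.set])]
    · simp [run, MAAP.set, MaxAffine.eval, Affine.eval, Affine.num, Function.update_apply]
    · rintro ⟨u', v'⟩ he hx
      simp [assigned, MAAP.set] at he hx
      grind
  · exact absurd h (hloop u)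
  · rw [run_forPar_of_mem (i := (v, u)) (by simp [hsymm _ _ h, huv])
      (by simp [assigned, MAAP.set])]
    · simp [run, MAAP.set, MaxAffine.eval, Affine.eval, Affine.num]
    · rintro ⟨u', v'⟩ he hx
      simp [assigned, MAAP.set] at he hx
      grind

theorem findInit_Y (σ : FlowVar V → ℝ) {i : ℕ} {v : V} (hi : 1 ≤ i) (hik : i ≤ k) (hv : v ≠ t) :
    (findInit E t k).run σ (Y i v) = 0 := by
  simp only [findInit, block_cons, block_nil, run]
  rw [run_forPar_of_mem (i := i) (by simp; omega) (by simp [assigned, MAAP.set, hv])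
    (by simp [assigned, MAAP.set]; grind), run_forPar_of_mem (i := v) (by simp [hv])
    (by simp [assigned, MAAP.set]) (by simp [assigned, MAAP.set]; grind)]
  simp [run, MAAP.set, MaxAffine.eval, Affine.eval, Affine.num, Function.update_apply]

theorem findInit_a (σ : FlowVar V → ℝ) {i : ℕ} {v : V} (hi : 1 ≤ i) (hik : i ≤ k) (hv : v ≠ t) :
    (findInit E t k).run σ (FlowVar.a i v) = 0 := by
  simp only [findInit, block_cons, block_nil, run]
  rw [run_forPar_of_mem (i := i) (by simp; omega) (by simp [assigned, MAAP.set, hv])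
    (by simp [assigned, MAAP.set]; grind), run_forPar_of_mem (i := v) (by simp [hv])
    (by simp [assigned, MAAP.set]) (by simp [assigned, MAAP.set]; grind)]
  simp [run, MAAP.set, MaxAffine.eval, Affine.eval, Affine.num, Function.update_apply]

theorem findInit_c (σ : FlowVar V → ℝ) (u v : V) :
    (findInit E t k).run σ (FlowVar.c u v) = σ (FlowVar.c u v) :=
  run_of_notMem_assigned _ (by simp [findInit, assigned, MAAP.set]) σ

/-! #### Fattest path values -/

theorem foldr_max_spec (b : ℝ) (l : List ℝ) :
    l.foldr (fun p q => p ⊔ q) b ∈ b :: l ∧ ∀ x ∈ b :: l, x ≤ l.foldr (fun p q => p ⊔ q) b := by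
  induction l with
  | nil => simp
  | cons d l ih =>
    simp only [List.foldr_cons]
    refine ⟨?_, fun x hx => ?_⟩
    · rcases max_choice d (l.foldr (fun p q => p ⊔ q) b) with h | h <;> rw [h]
      · simp
      · have := ih.1
        simp only [List.mem_cons] at this ⊢
        tauto
    · simp only [List.mem_cons] at hx
      rcases hx with rfl | rfl | hx
      · exact le_max_of_le_right (ih.2 _ (by simp))
      · exact le_max_left _ _
      · exact le_max_of_le_right (ih.2 _ (by simp [hx]))

theorem run_setMax_spec {X : Type*} (x : X) {es : List (Affine X)} (h : es ≠ []) (σ : X → ℝ) :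
    (∃ e ∈ es, (setMax x es).run σ x = e.eval σ) ∧
      ∀ e ∈ es, e.eval σ ≤ (setMax x es).run σ x := by
  cases es with
  | nil => exact absurd rfl h
  | cons e es =>
    have hspec := foldr_max_spec (e.eval σ) (es.map fun d => d.eval σ)
    rw [← List.map_cons (f := fun d : Affine X => d.eval σ)] at hspec
    simp only [setMax, run, Function.update_self, MaxAffine.eval]
    obtain ⟨d, hd, heq⟩ := List.mem_map.1 hspec.1
    exact ⟨⟨d, hd, heq.symm⟩, fun d hd => hspec.2 _ (List.mem_map.2 ⟨d, hd, rfl⟩)⟩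

/-- One iteration `i` of the computation of the fattest path values. -/
noncomputable def fattestStep (E : Finset (V × V)) (t : V) (i : ℕ) : MAAP (FlowVar V) :=
  forPar (nodesWithout t) fun v =>
    block [
      forPar (succWithout E t v) fun w =>
        setMin (g v w) (.var (FlowVar.a (i - 1) w)) [.var (FlowVar.c v w)],
      setMax (FlowVar.a i v) ((succWithout E t v).map fun w => .var (g v w))]

theorem fattestStep_of_ne (σ : FlowVar V → ℝ) {i l : ℕ} (v : V) (h : l ≠ i) :
    (fattestStep E t i).run σ (FlowVar.a l v) = σ (FlowVar.a l v) :=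
  run_of_notMem_assigned _ (by simp [fattestStep, assigned, setMin, h]) σ

theorem fattestStep_of_empty (σ : FlowVar V → ℝ) {i : ℕ} {v : V} (h : succWithout E t v = []) :
    (fattestStep E t i).run σ (FlowVar.a i v) = σ (FlowVar.a i v) :=
  run_of_notMem_assigned _ (by simp [fattestStep, assigned, setMin]; grind) σ

theorem fattestStep_c (σ : FlowVar V → ℝ) (i : ℕ) (u v : V) :
    (fattestStep E t i).run σ (FlowVar.c u v) = σ (FlowVar.c u v) :=
  run_of_notMem_assigned _ (by simp [fattestStep, assigned, setMin]) σ

theorem fattestStep_spec (σ : FlowVar V → ℝ) {i : ℕ} {v : V} (hv : v ≠ t)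
    (h : succWithout E t v ≠ []) :
    (∃ w ∈ succWithout E t v, (fattestStep E t i).run σ (FlowVar.a i v) =
      min (σ (FlowVar.a (i - 1) w)) (σ (FlowVar.c v w))) ∧
    ∀ w ∈ succWithout E t v, min (σ (FlowVar.a (i - 1) w)) (σ (FlowVar.c v w)) ≤
      (fattestStep E t i).run σ (FlowVar.a i v) := by
  have hg : ∀ w ∈ succWithout E t v, (Affine.var (g v w)).eval ((forPar (succWithout E t v)
      fun w => setMin (g v w) (.var (FlowVar.a (i - 1) w)) [.var (FlowVar.c v w)]).run σ) =
      min (σ (FlowVar.a (i - 1) w)) (σ (FlowVar.c v w)) := by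
    intro w hw
    simp only [Affine.eval, Affine.var, List.map_cons, List.map_nil, List.sum_cons, List.sum_nil,
      one_mul, add_zero, zero_add]
    rw [run_forPar_of_mem hw (by simp [assigned, setMin]) (by simp [assigned, setMin]; grind)]
    simp [run, setMin, MaxAffine.eval, Affine.eval, min_comm]
  rw [fattestStep, run_forPar_of_mem (i := v) (by simp [hv])
    (by simp only [block_cons, block_nil, assigned, Set.mem_union, assigned_setMax]
        exact Or.inr (Or.inl ⟨by simpa using h, trivial⟩))
    (by simp [assigned, setMin]; grind)]
  simp only [block_cons, block_nil, run]
  obtain ⟨⟨e, he, heq⟩, hle⟩ := run_setMax_spec (FlowVar.a i v)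
    (es := (succWithout E t v).map fun w => .var (g v w)) (by simpa using h)
    ((forPar (succWithout E t v) fun w =>
      setMin (g v w) (.var (FlowVar.a (i - 1) w)) [.var (FlowVar.c v w)]).run σ)
  obtain ⟨w, hw, rfl⟩ := List.mem_map.1 he
  refine ⟨⟨w, hw, heq.trans (hg w hw)⟩, fun w hw => ?_⟩
  rw [← hg w hw]
  exact hle _ (List.mem_map.2 ⟨w, hw, rfl⟩)

theorem findFattest_isFattest (hk : 1 ≤ k) (hc : ∀ e ∈ E, 0 ≤ c e)
    {σ : FlowVar V → ℝ} (hσc : ∀ u v, σ (FlowVar.c u v) = c (u, v))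
    (hσa : ∀ i v, 1 ≤ i → i ≤ k → v ≠ t → σ (FlowVar.a i v) = 0) :
    IsFattest E c t k fun i v => (findFattest E t k).run σ (FlowVar.a i v) := by
  -- Before iteration `i` the values below index `i` are final and the others are still `0`. This
  -- default is the right value at nodes whose maximum is over the empty set.
  let P : ℕ → (FlowVar V → ℝ) → Prop := fun i σ =>
    (∀ u v, σ (FlowVar.c u v) = c (u, v)) ∧
    IsFattest E c t (i - 1) (fun i v => σ (FlowVar.a i v)) ∧
    ∀ l v, i ≤ l → l ≤ k → v ≠ t → σ (FlowVar.a l v) = 0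
  have key : P (2 + (k - 1)) ((findFattest E t k).run σ) := by
    refine forDo_range'_induction P 2 (k - 1) (body := fattestStep E t) ?_ ?_
    · rintro i σ hi hik ⟨h1, h2, h3⟩
      refine ⟨fun u v => (fattestStep_c σ i u v).trans (h1 u v), ⟨?_, ?_, ?_, ?_, ?_⟩, ?_⟩
      · intro l v hl hli hv
        by_cases hl' : l = i
        · subst hl'
          by_cases hs : succWithout E t v = []
          · rw [fattestStep_of_empty σ hs, h3 l v le_rfl (by omega) hv]
          · obtain ⟨⟨w, hw, heq⟩, -⟩ := fattestStep_spec (i := l) σ hv hs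
            rw [heq]
            rw [mem_succWithout] at hw
            exact le_min (h2.nonneg _ w (by omega) le_rfl hw.2) (h1 v w ▸ hc _ hw.1)
        · rw [fattestStep_of_ne σ v hl']
          exact h2.nonneg l v hl (by omega) hv
      · intro v hE
        rw [fattestStep_of_ne σ v (by omega)]
        exact h2.one_of_mem v hE
      · intro v hv hE
        rw [fattestStep_of_ne σ v (by omega)]
        exact h2.one_of_notMem v hv hE
      · intro l v w hl hli hv hw hE
        rw [fattestStep_of_ne σ w (by omega)]
        by_cases hl' : l + 1 = i
        · subst hl'
          have hmem : w ∈ succWithout E t v := by simp [hE, hw]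
          have := (fattestStep_spec (i := l + 1) σ hv (List.ne_nil_of_mem hmem)).2 w hmem
          rwa [h1 v w] at this
        · rw [fattestStep_of_ne σ v hl']
          exact h2.le l v w hl (by omega) hv hw hE
      · intro l v hl hli hv hpos
        beta_reduce at hpos ⊢
        by_cases hl' : l + 1 = i
        · subst hl'
          by_cases hs : succWithout E t v = []
          · rw [fattestStep_of_empty σ hs, h3 _ v le_rfl (by omega) hv] at hpos
            exact absurd hpos (lt_irrefl 0)
          · obtain ⟨⟨w, hw, heq⟩, -⟩ := fattestStep_spec (i := l + 1) σ hv hs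
            rw [mem_succWithout] at hw
            refine ⟨w, hw.2, hw.1, ?_⟩
            rw [fattestStep_of_ne σ w (by omega), heq, h1 v w]
            rfl
        · rw [fattestStep_of_ne σ v hl'] at hpos ⊢
          obtain ⟨w, hw, hE, hle⟩ := h2.exists_le l v hl (by omega) hv hpos
          refine ⟨w, hw, hE, ?_⟩
          rwa [fattestStep_of_ne σ w (by omega)]
      · intro l v hl hlk hv
        rw [fattestStep_of_ne σ v (by omega)]
        exact h3 l v (by omega) hlk hv
    · have hone : ∀ v, (v, t) ∈ E → (forPar (predSink E t) fun v =>
          MAAP.set (FlowVar.a 1 v) (.var (FlowVar.c v t))).run σ (FlowVar.a 1 v) = c (v, t) := by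
        intro v hE
        rw [run_forPar_of_mem (i := v) (by simp [hE]) (by simp [assigned, MAAP.set])
          (by simp [assigned, MAAP.set]; grind)]
        simp [run, MAAP.set, MaxAffine.eval, Affine.eval, Affine.var, hσc]
      have hzero : ∀ v, v ≠ t → (v, t) ∉ E → (forPar (predSink E t) fun v =>
          MAAP.set (FlowVar.a 1 v) (.var (FlowVar.c v t))).run σ (FlowVar.a 1 v) = 0 := by
        intro v hv hE
        rw [run_of_notMem_assigned _ (by simp [assigned, MAAP.set]; grind),
          hσa 1 v le_rfl hk hv]
      refine ⟨fun u v => ?_, ⟨?_, hone, hzero, ?_, ?_⟩, ?_⟩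
      · rw [run_of_notMem_assigned _ (by simp [assigned, MAAP.set]), hσc]
      · intro i v h1 h2 hv
        obtain rfl : i = 1 := by omega
        by_cases hE : (v, t) ∈ E
        · exact (hc _ hE).trans (hone v hE).ge
        · exact (hzero v hv hE).ge
      · omega
      · omega
      · intro l v h1 h2 hv
        rw [run_of_notMem_assigned _ (by simp [assigned, MAAP.set]; omega),
          hσa l v (by omega) h2 hv]
  have := key.2.1
  rwa [show 2 + (k - 1) - 1 = k by omega] at this

end Program

/-! ### Semantics of the program: pushing, clean-up and the main loop -/

section Program

variable {V : Type*} [Fintype V] [LinearOrder V] {E : Finset (V × V)} {c : V × V → ℝ} {s t : V}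
  {k : ℕ} {a : ℕ → V → ℝ}

open MAAP FlowVar

/-! #### Pushing flow -/

/-- The values of the variables `z`. -/
def flowOf (σ : FlowVar V → ℝ) (e : V × V) : ℝ := σ (z e.1 e.2)

/-- The values of the variables `Y`. -/
def excessOf (σ : FlowVar V → ℝ) (i : ℕ) (v : V) : ℝ := σ (Y i v)

/-- The values of the variables `c`. -/
def capacityOf (σ : FlowVar V → ℝ) (e : V × V) : ℝ := σ (FlowVar.c e.1 e.2)

/-- The values of the variables `a`. -/
def fattestOf (σ : FlowVar V → ℝ) (i : ℕ) (v : V) : ℝ := σ (FlowVar.a i v)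

/-- Push excess of `v` on level `i` along `vw`. -/
noncomputable def pushStep (i : ℕ) (v w : V) : MAAP (FlowVar V) :=
  block [
    setMin f (.var (Y i v)) [.var (FlowVar.c v w), .sub (FlowVar.a (i - 1) w) (Y (i - 1) w)],
    MAAP.set (z v w) (.add (z v w) f),
    MAAP.set (Y i v) (.sub (Y i v) f),
    MAAP.set (Y (i - 1) w) (.add (Y (i - 1) w) f)]

/-- Return excess of `w` on level `i` along `vw`. -/
noncomputable def cleanUpStep (i : ℕ) (w v : V) : MAAP (FlowVar V) :=
  block [
    setMin b (.var (Y i w)) [.var (z v w)],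
    MAAP.set (z v w) (.sub (z v w) b),
    MAAP.set (Y i w) (.sub (Y i w) b),
    MAAP.set (Y (i + 1) v) (.add (Y (i + 1) v) b)]

omit [Fintype V] in
theorem pushStep_z (σ : FlowVar V → ℝ) (j : ℕ) (v w : V) :
    flowOf ((pushStep (j + 1) v w).run σ) = shiftFlow (flowOf σ) v w
      (min (excessOf σ (j + 1) v) (min (capacityOf σ (v, w))
        (fattestOf σ j w - excessOf σ j w))) := by
  funext ⟨u, u'⟩
  by_cases h : u = v ∧ u' = w
  · obtain ⟨rfl, rfl⟩ := h
    simp [flowOf, excessOf, capacityOf, fattestOf, pushStep, run, MAAP.set, setMin,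
      MaxAffine.eval, Affine.eval, Affine.add, Affine.sub, Affine.var, Function.update_apply,
      shiftFlow, ← sub_eq_add_neg, min_comm]
    exact (min_assoc _ _ _).symm
  · simp [flowOf, pushStep, run, MAAP.set, setMin, shiftFlow, h]

omit [Fintype V] in
theorem pushStep_Y (σ : FlowVar V → ℝ) (j : ℕ) (v w : V) :
    excessOf ((pushStep (j + 1) v w).run σ) = shiftExcess (excessOf σ) j v w
      (min (excessOf σ (j + 1) v) (min (capacityOf σ (v, w))
        (fattestOf σ j w - excessOf σ j w))) := by
  funext i u
  by_cases h1 : i = j + 1 ∧ u = v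
  · obtain ⟨rfl, rfl⟩ := h1
    simp [excessOf, capacityOf, fattestOf, pushStep, run, MAAP.set, setMin,
      MaxAffine.eval, Affine.eval, Affine.add, Affine.sub, Affine.var, Function.update_apply,
      shiftExcess, ← sub_eq_add_neg, min_comm]
    exact (min_assoc _ _ _).symm
  · by_cases h2 : i = j ∧ u = w
    · obtain ⟨rfl, rfl⟩ := h2
      simp [excessOf, capacityOf, fattestOf, pushStep, run, MAAP.set, setMin,
        MaxAffine.eval, Affine.eval, Affine.add, Affine.sub, Affine.var, Function.update_apply,
        shiftExcess, ← sub_eq_add_neg, min_comm]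
      exact (min_assoc _ _ _).symm
    · simp [excessOf, pushStep, run, MAAP.set, setMin, shiftExcess, h1, h2]

omit [Fintype V] [LinearOrder V] in
theorem pushStep_c (σ : FlowVar V → ℝ) (i : ℕ) (v w : V) :
    capacityOf ((pushStep i v w).run σ) = capacityOf σ :=
  funext fun e => run_of_notMem_assigned _ (by simp [pushStep, assigned, MAAP.set, setMin]) σ

omit [Fintype V] [LinearOrder V] in
theorem pushStep_a (σ : FlowVar V → ℝ) (i : ℕ) (v w : V) :
    fattestOf ((pushStep i v w).run σ) = fattestOf σ :=
  funext fun i => funext fun e =>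
    run_of_notMem_assigned _ (by simp [pushStep, assigned, MAAP.set, setMin]) σ

omit [Fintype V] in
theorem cleanUpStep_z (σ : FlowVar V → ℝ) (j : ℕ) (v w : V) :
    flowOf ((cleanUpStep j w v).run σ) = shiftFlow (flowOf σ) v w
      (-(min (excessOf σ j w) (flowOf σ (v, w)))) := by
  funext ⟨u, u'⟩
  by_cases h : u = v ∧ u' = w
  · obtain ⟨rfl, rfl⟩ := h
    simp [flowOf, excessOf, cleanUpStep, run, MAAP.set, setMin, MaxAffine.eval, Affine.eval,
      Affine.sub, Affine.var, Function.update_apply, shiftFlow, min_comm]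
  · simp [flowOf, cleanUpStep, run, MAAP.set, setMin, shiftFlow, h]

omit [Fintype V] in
theorem cleanUpStep_Y (σ : FlowVar V → ℝ) (j : ℕ) (v w : V) :
    excessOf ((cleanUpStep j w v).run σ) = shiftExcess (excessOf σ) j v w
      (-(min (excessOf σ j w) (flowOf σ (v, w)))) := by
  funext i u
  by_cases h1 : i = j + 1 ∧ u = v
  · obtain ⟨rfl, rfl⟩ := h1
    simp [flowOf, excessOf, cleanUpStep, run, MAAP.set, setMin, MaxAffine.eval, Affine.eval,
      Affine.sub, Affine.add, Affine.var, Function.update_apply, shiftExcess, min_comm]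
  · by_cases h2 : i = j ∧ u = w
    · obtain ⟨rfl, rfl⟩ := h2
      simp [flowOf, excessOf, cleanUpStep, run, MAAP.set, setMin, MaxAffine.eval, Affine.eval,
        Affine.sub, Affine.var, Function.update_apply, shiftExcess, min_comm]
    · simp [excessOf, cleanUpStep, run, MAAP.set, setMin, shiftExcess,
        h1, h2]

/-- The loop of the pushing phase establishes the invariant for level `1`. -/
theorem pushLoop (hloop : ∀ v, (v, v) ∉ E) (ha : IsFattest E c t k a) (H : NoShortWalk E c s t k)
    (hk : 1 ≤ k) {σ : FlowVar V → ℝ} (hc : capacityOf σ = c) (hσa : fattestOf σ = a)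
    (h : PushInv E c s t k a k (fun _ _ => False) (flowOf σ) (excessOf σ)) {σ' : FlowVar V → ℝ}
    (hσ' : σ' = (forDo (List.range' 2 (k - 1)).reverse fun i => forDo (nodesWithout t) fun v =>
      forDo (succWithout E t v) fun w => pushStep i v w).run σ) :
    PushInv E c s t k a 1 (fun _ _ => False) (flowOf σ') (excessOf σ') := by
  let Q : ℕ → (V → V → Prop) → (FlowVar V → ℝ) → Prop := fun j rem σ =>
    capacityOf σ = c ∧ fattestOf σ = a ∧ PushInv E c s t k a j rem (flowOf σ) (excessOf σ)
  have hQ : ∀ {j rem rem' σ}, (∀ v w, rem v w ↔ rem' v w) → Q j rem σ → Q j rem' σ := by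
    intro j rem rem' σ h hQ
    obtain rfl : rem = rem' := funext fun v => funext fun w => propext (h v w)
    exact hQ
  suffices Q 1 (fun _ _ => False) σ' from this.2.2
  rw [hσ']
  refine forDo_reverse_range'_induction (fun i σ => Q (i - 1) (fun _ _ => False) σ) 2 (k - 1) ?_ ?_
  · intro i σ hi hik hσ
    obtain ⟨j, rfl⟩ : ∃ j, i = j + 1 := ⟨i - 1, by omega⟩
    simp only [Nat.add_sub_cancel] at hσ ⊢
    have hstart : Q j (fun v w => v ∈ nodesWithout t ∧ (v, w) ∈ E ∧ w ≠ t) σ :=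
      ⟨hσ.1, hσ.2.1, hσ.2.2.next_level H fun v w hE hv hw => ⟨by simpa using hv, hE, hw⟩⟩
    refine hQ ?_ (forDo_induction (fun L => Q j fun v w => v ∈ L ∧ (v, w) ∈ E ∧ w ≠ t)
      nodup_nodesWithout ?_ hstart)
    · simp
    intro v L σ hv hvL _ hσ
    -- Still to be treated are the arcs with tail in `L` and those from the current `v` to a head in
    -- `M`.
    refine hQ ?_ (forDo_induction (fun M => Q j fun v' w => (v' ∈ L ∧ (v', w) ∈ E ∧ w ≠ t) ∨
      (v' = v ∧ w ∈ M)) (nodup_succWithout v) ?_ (hQ ?_ hσ))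
    · simp
    · intro w M σ hw hwM hM hσ
      rw [mem_nodesWithout] at hv
      rw [mem_succWithout] at hw
      obtain ⟨h1, h2, h3⟩ := hσ
      refine ⟨(pushStep_c σ _ v w).trans h1, (pushStep_a σ _ v w).trans h2, ?_⟩
      rw [pushStep_z, pushStep_Y, h1, h2]
      refine h3.step ha H (by omega) (by omega) hv hw.2 hw.1 ?_ ?_ ?_ ?_ ?_ rfl
      · rintro rfl
        exact hloop _ hw.1
      · simp
      · simp [hvL, hwM]
      · intro v' w' h
        simp only [List.mem_cons]
        tauto
      · intro v' w' h
        simp only [List.mem_cons] at h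
        tauto
    · intro v' w
      simp only [List.mem_cons, mem_succWithout]
      constructor
      · rintro ⟨rfl | h1, h2⟩
        · exact Or.inr ⟨rfl, h2⟩
        · exact Or.inl ⟨h1, h2⟩
      · rintro (⟨h1, h2⟩ | ⟨rfl, h2⟩)
        · exact ⟨Or.inr h1, h2⟩
        · exact ⟨Or.inl rfl, h2⟩
  · rw [show 2 + (k - 1) - 1 = k by omega]
    exact ⟨hc, hσa, h⟩

/-- The clean-up phase turns the flow into an augmentation. -/
theorem findCleanUp_isAugmentation (hloop : ∀ v, (v, v) ∉ E) (H : NoShortWalk E c s t k)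
    {S : ℝ} {σ : FlowVar V → ℝ}
    (h : CleanUpInv E c s t k S 2 (fun _ _ => True) (flowOf σ) (excessOf σ)) :
    IsAugmentation E c s t k (flowOf ((findCleanUp E t k).run σ)) := by
  let Q : ℕ → (V → V → Prop) → (FlowVar V → ℝ) → Prop := fun j rem σ =>
    CleanUpInv E c s t k S j rem (flowOf σ) (excessOf σ)
  have hQ : ∀ {j rem rem' σ}, (∀ v w, rem v w → rem' v w) → Q j rem σ → Q j rem' σ :=
    fun h hQ => { hQ with
      cleared := fun v w h1 h2 h3 h4 => hQ.cleared v w h1 h2 h3 fun h5 => h4 (h v w h5) }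
  have key : Q (2 + (k - 2)) (fun _ _ => True) ((findCleanUp E t k).run σ) := by
    refine forDo_range'_induction (fun i σ => Q i (fun _ _ => True) σ) 2 (k - 2) ?_ h
    intro j σ hj hjk hσ
    have hstart : Q j (fun v w => w ∈ (nodesWithout t).reverse ∧ (v, w) ∈ E ∧ v ≠ t) σ :=
      { hσ with
        cleared := fun v w hE hv hw hn => absurd ⟨by simpa using hw, hE, hv⟩ hn }
    refine CleanUpInv.next_level H (by omega) (by omega) (hQ ?_ (forDo_induction
      (fun L => Q j fun v w => w ∈ L ∧ (v, w) ∈ E ∧ v ≠ t)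
      (List.nodup_reverse.2 nodup_nodesWithout) ?_ hstart)) (fun _ _ _ _ _ => trivial)
    · simp
    intro w L σ hw hwL _ hσ
    refine hQ ?_ (forDo_induction (fun M => Q j fun v w' => (w' ∈ L ∧ (v, w') ∈ E ∧ v ≠ t) ∨
      (w' = w ∧ v ∈ M)) (List.nodup_reverse.2 (nodup_predWithout w)) ?_ (hQ ?_ hσ))
    · simp
    · intro v M σ hv _ _ hσ
      rw [List.mem_reverse, mem_nodesWithout] at hw
      rw [List.mem_reverse, mem_predWithout] at hv
      change CleanUpInv _ _ _ _ _ _ _ _ (flowOf ((cleanUpStep j w v).run σ))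
        (excessOf ((cleanUpStep j w v).run σ))
      rw [cleanUpStep_z, cleanUpStep_Y]
      refine CleanUpInv.step H hσ (by omega) (by omega) hv.2 hw hv.1 ?_ ?_ rfl
      · rintro rfl
        exact hloop _ hv.1
      · intro v' w' h
        simp only [List.mem_cons] at h
        tauto
    · intro v w'
      simp only [List.mem_cons, List.mem_reverse, mem_predWithout]
      rintro ⟨rfl | h1, h2⟩
      · exact Or.inr ⟨rfl, h2⟩
      · exact Or.inl ⟨h1, h2⟩
  -- The truncated `2 + (k - 2)` is at least `k` also for `k = 1`, where the loop is empty.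
  exact key.isAugmentation H (by omega)

/-- The subroutine computes an augmentation `z`, and returns its values `z uv - z vu`. -/
theorem findAugmentingFlow_spec (hst : s ≠ t) (hloop : ∀ v, (v, v) ∉ E)
    (hsymm : ∀ u v, (u, v) ∈ E → (v, u) ∈ E) (hk : 1 ≤ k) (σ : FlowVar V → ℝ)
    (hc : ∀ e ∈ E, 0 ≤ capacityOf σ e) (H : NoShortWalk E (capacityOf σ) s t k) :
    ∃ z' : V × V → ℝ, IsAugmentation E (capacityOf σ) s t k z' ∧ ∀ e ∈ forwardArcs E,
      (findAugmentingFlow E s t k).run σ (y e.1 e.2) = z' e - z' e.swap := by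
  obtain ⟨σ₁, hσ₁⟩ : ∃ σ₁, σ₁ = (findInit E t k).run σ := ⟨_, rfl⟩
  obtain ⟨σ₂, hσ₂⟩ : ∃ σ₂, σ₂ = (findFattest E t k).run σ₁ := ⟨_, rfl⟩
  obtain ⟨σ₃, hσ₃⟩ : ∃ σ₃, σ₃ = (findPush E s t k).run σ₂ := ⟨_, rfl⟩
  obtain ⟨σ₄, hσ₄⟩ : ∃ σ₄, σ₄ = (findCleanUp E t k).run σ₃ := ⟨_, rfl⟩
  have hc1 : capacityOf σ₁ = capacityOf σ := funext fun e => hσ₁ ▸ findInit_c σ e.1 e.2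
  have hc2 : capacityOf σ₂ = capacityOf σ := by
    rw [← hc1, hσ₂]
    exact funext fun e =>
      run_of_notMem_assigned _ (by simp [findFattest, assigned, MAAP.set, setMin]) σ₁
  have ha : IsFattest E (capacityOf σ) t k (fattestOf σ₂) := by
    rw [hσ₂]
    exact findFattest_isFattest hk hc (fun u v => congrFun hc1 (u, v))
      fun i v h1 h2 h3 => hσ₁ ▸ findInit_a σ h1 h2 h3
  have hz2 : ∀ e ∈ E, flowOf σ₂ e = 0 := fun e he => by
    rw [hσ₂, flowOf, run_of_notMem_assigned _ (by simp [findFattest, assigned, MAAP.set, setMin]),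
      hσ₁]
    exact findInit_z hloop hsymm σ he
  have hY2 : ∀ i v, 1 ≤ i → i ≤ k → v ≠ t → excessOf σ₂ i v = 0 := fun i v h1 h2 h3 => by
    rw [hσ₂, excessOf,
      run_of_notMem_assigned _ (by simp [findFattest, assigned, MAAP.set, setMin]), hσ₁]
    exact findInit_Y σ h1 h2 h3
  let τ₁ := (MAAP.set (Y k s) (.var (FlowVar.a k s))).run σ₂
  let τ₂ := (forDo (List.range' 2 (k - 1)).reverse fun i => forDo (nodesWithout t) fun v =>
      forDo (succWithout E t v) fun w => pushStep i v w).run τ₁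
  have hτc : capacityOf τ₁ = capacityOf σ := by
    rw [← hc2]
    exact funext fun e => run_of_notMem_assigned _ (by simp [assigned, MAAP.set]) σ₂
  have hτa : fattestOf τ₁ = fattestOf σ₂ :=
    funext fun i => funext fun v => run_of_notMem_assigned _ (by simp [assigned, MAAP.set]) σ₂
  have hτY : ∀ i v, ¬ (i = k ∧ v = s) → excessOf τ₁ i v = excessOf σ₂ i v := fun i v h =>
    run_of_notMem_assigned _ (by simpa [assigned, MAAP.set] using h) σ₂
  have hpush := pushLoop hloop ha H hk hτc hτa (PushInv.init ha H hst hk hc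
    (fun e he => (run_of_notMem_assigned _ (by simp [assigned, MAAP.set]) σ₂).trans (hz2 e he))
    (by simp [excessOf, τ₁, run, MAAP.set, MaxAffine.eval, Affine.eval, Affine.var, fattestOf])
    (fun i v h1 h2 h3 h4 => (hτY i v fun h => h4 h.1 h.2).trans (hY2 i v h1 h2 h3)))
    (σ' := τ₂) rfl
  have hσ₃' : σ₃ = (forPar (predSink E t) fun v =>
      block [MAAP.set (z v t) (.var (Y 1 v)), MAAP.set (Y 1 v) (.num 0)]).run τ₂ := hσ₃
  have hclean : CleanUpInv E (capacityOf σ) s t k (fattestOf σ₂ k s) 2 (fun _ _ => True)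
      (flowOf σ₃) (excessOf σ₃) := by
    refine hpush.cleanUpInv ha H hloop hst hk ?_ ?_ ?_ ?_ fun _ _ _ _ _ => trivial
    · intro v hE
      rw [hσ₃', flowOf, run_forPar_of_mem (i := v) (by simp [hE]) (by simp [assigned, MAAP.set])
        (by simp [assigned, MAAP.set]; grind)]
      simp [run, MAAP.set, MaxAffine.eval, Affine.eval, Affine.var, Function.update_apply,
        excessOf]
    · intro e _ het
      rw [hσ₃', flowOf, run_of_notMem_assigned _ (by simp [assigned, MAAP.set, het])]
      rfl
    · intro v hE
      rw [hσ₃', excessOf, run_forPar_of_mem (i := v) (by simp [hE])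
        (by simp [assigned, MAAP.set]) (by simp [assigned, MAAP.set]; grind)]
      simp [run, MAAP.set, MaxAffine.eval, Affine.eval, Affine.num]
    · intro i v _ _ _ h
      rw [hσ₃', excessOf, run_of_notMem_assigned _ (by simp [assigned, MAAP.set]; grind)]
      rfl
  have hfinal := findCleanUp_isAugmentation hloop H hclean
  rw [← hσ₄] at hfinal
  refine ⟨flowOf σ₄, hfinal, fun e he => ?_⟩
  have hrun : (findAugmentingFlow E s t k).run σ = (forPar (forwardArcs E).toList fun e =>
      MAAP.set (y e.1 e.2) (.sub (z e.1 e.2) (z e.2 e.1))).run σ₄ := by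
    rw [hσ₄, hσ₃, hσ₂, hσ₁]
    rfl
  rw [hrun, run_forPar_of_mem (i := e) (by simpa using he) (by simp [assigned, MAAP.set])
    (by simp [assigned, MAAP.set]; grind)]
  simp [run, MAAP.set, MaxAffine.eval, Affine.eval, Affine.sub, flowOf, sub_eq_add_neg]

/-! #### The main loop -/

/-- One augmentation. -/
noncomputable def augmentStep (E : Finset (V × V)) (s t : V) (k : ℕ) : MAAP (FlowVar V) :=
  block [
    findAugmentingFlow E s t k,
    forPar (forwardArcs E).toList fun e =>
      block [
        MAAP.set (x e.1 e.2) (.add (x e.1 e.2) (y e.1 e.2)),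
        MAAP.set (FlowVar.c e.1 e.2) (.sub (FlowVar.c e.1 e.2) (y e.1 e.2)),
        MAAP.set (FlowVar.c e.2 e.1) (.add (FlowVar.c e.2 e.1) (y e.1 e.2))]]

/-- The values of the variables `x`. -/
def valueOf (σ : FlowVar V → ℝ) (e : V × V) : ℝ := σ (x e.1 e.2)

/-- The invariant of the main loop: `x` is a flow and `c` are its residual capacities. -/
structure MainInv (E : Finset (V × V)) (s t : V) (ν : V × V → ℝ) (σ : FlowVar V → ℝ) : Prop where
  capacity_nonneg : ∀ e ∈ E, 0 ≤ capacityOf σ e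
  capacity_eq : ∀ e ∈ E, capacityOf σ e = residualCapacity ν (valueOf σ) e
  conservation : ∀ v, v ≠ s → v ≠ t → outSum E (fun e => ν e - capacityOf σ e) v = 0

/-- Truncated subtraction covers the case without a `k`-arc walk: then there are no level arcs
before or after the step. -/
theorem augmentStep_spec (hst : s ≠ t) (hloop : ∀ v, (v, v) ∉ E)
    (hsymm : ∀ u v, (u, v) ∈ E → (v, u) ∈ E) (hk : 1 ≤ k) {ν : V × V → ℝ} {σ : FlowVar V → ℝ}
    (h : MainInv E s t ν σ) (H : NoShortWalk E (capacityOf σ) s t k) :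
    MainInv E s t ν ((augmentStep E s t k).run σ) ∧
    NoShortWalk E (capacityOf ((augmentStep E s t k).run σ)) s t k ∧
    (levelArcs E (capacityOf ((augmentStep E s t k).run σ)) s t k).card ≤
      (levelArcs E (capacityOf σ) s t k).card - 1 := by
  obtain ⟨z', hz', hy⟩ := findAugmentingFlow_spec hst hloop hsymm hk σ h.capacity_nonneg H
  obtain ⟨σ₁, hσ₁⟩ : ∃ σ₁, σ₁ = (findAugmentingFlow E s t k).run σ := ⟨_, rfl⟩
  rw [← hσ₁] at hy
  have hσ₁c : ∀ u v, σ₁ (FlowVar.c u v) = σ (FlowVar.c u v) := fun u v => by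
    rw [hσ₁]
    exact run_of_notMem_assigned _ (by simp [findAugmentingFlow, findInit, findFattest, findPush,
      findCleanUp, assigned, MAAP.set, setMin]) σ
  have hσ₁x : ∀ u v, σ₁ (x u v) = σ (x u v) := fun u v => by
    rw [hσ₁]
    exact run_of_notMem_assigned _ (by simp [findAugmentingFlow, findInit, findFattest, findPush,
      findCleanUp, assigned, MAAP.set, setMin]) σ
  obtain ⟨σ₂, hσ₂⟩ : ∃ σ₂, σ₂ = (augmentStep E s t k).run σ := ⟨_, rfl⟩
  rw [← hσ₂]
  have hσ₂' : σ₂ = (forPar (forwardArcs E).toList fun e =>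
      block [
        MAAP.set (x e.1 e.2) (.add (x e.1 e.2) (y e.1 e.2)),
        MAAP.set (FlowVar.c e.1 e.2) (.sub (FlowVar.c e.1 e.2) (y e.1 e.2)),
        MAAP.set (FlowVar.c e.2 e.1) (.add (FlowVar.c e.2 e.1) (y e.1 e.2))]).run σ₁ := by
    rw [hσ₂, hσ₁]
    rfl
  have hfwd : ∀ u v, (u, v) ∈ E → u < v →
      σ₂ (x u v) = σ (x u v) + (z' (u, v) - z' (v, u)) ∧
      σ₂ (FlowVar.c u v) = σ (FlowVar.c u v) - (z' (u, v) - z' (v, u)) ∧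
      σ₂ (FlowVar.c v u) = σ (FlowVar.c v u) + (z' (u, v) - z' (v, u)) := by
    intro u v hE huv
    have hy' : σ₁ (y u v) = z' (u, v) - z' (v, u) := hy (u, v) (by simp [hE, huv])
    refine ⟨?_, ?_, ?_⟩
    all_goals
      rw [hσ₂', run_forPar_of_mem (i := (u, v)) (by simp [hE, huv]) (by simp [assigned, MAAP.set])
        (by simp [assigned, MAAP.set]; grind)]
      simp [run, MAAP.set, MaxAffine.eval, Affine.eval, Affine.sub, Affine.add,
        Function.update_apply, hy', hσ₁c, hσ₁x, huv.ne, huv.ne', sub_eq_add_neg]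
  have hcap : ∀ e ∈ E, capacityOf σ₂ e = capacityOf σ e - z' e + z' e.swap := by
    rintro ⟨u, v⟩ he
    rcases lt_trichotomy u v with huv | rfl | huv
    · have := (hfwd u v he huv).2.1
      simp only [capacityOf, Prod.swap_prod_mk]
      linarith
    · exact absurd he (hloop u)
    · have := (hfwd v u (hsymm _ _ he) huv).2.2
      simp only [capacityOf, Prod.swap_prod_mk]
      linarith
  refine ⟨⟨?_, ?_, ?_⟩, (hz'.isLevelUpdate hsymm hcap).noShortWalk H, ?_⟩
  · intro e he
    rw [hcap e he]
    have := hz'.le e he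
    have := hz'.nonneg e.swap (hsymm _ _ he)
    linarith
  · rintro ⟨u, v⟩ he
    have h1 := h.capacity_eq _ he
    rcases lt_trichotomy u v with huv | rfl | huv
    · have := hfwd u v he huv
      simp only [residualCapacity, capacityOf, valueOf, huv, if_true] at h1 ⊢
      linarith
    · exact absurd he (hloop u)
    · have := hfwd v u (hsymm _ _ he) huv
      simp only [residualCapacity, capacityOf, valueOf, huv.not_gt, if_false,
        Prod.swap_prod_mk] at h1 ⊢
      linarith
  · intro v hvs hvt
    have h1 := h.conservation v hvs hvt
    have h2 := hz'.conservation v hvs hvt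
    rw [netOutflow_eq, inSum_eq hsymm] at h2
    have h3 : outSum E (fun e => ν e - capacityOf σ₂ e) v =
        outSum E (fun e => ν e - capacityOf σ e) v +
          (outSum E z' v - outSum E (fun e => z' e.swap) v) := by
      simp only [outSum, ← Finset.sum_sub_distrib, ← Finset.sum_add_distrib]
      refine Finset.sum_congr rfl fun e he => ?_
      rw [hcap e (Finset.mem_filter.1 he).1]
      ring
    rw [h3, h1, h2, add_zero]
  · by_cases hwalk : WalkOfLength (ResidualArc E (capacityOf σ)) k s t
    · have := Finset.card_lt_card (hz'.levelArcs_ssubset hsymm H hcap hwalk)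
      omega
    · have h0 : levelArcs E (capacityOf σ) s t k = ∅ := by
        rw [← Finset.not_nonempty_iff_eq_empty]
        rintro ⟨e, he⟩
        simp only [levelArcs, Finset.mem_filter] at he
        obtain ⟨-, -, i, h1, -⟩ := he
        exact hwalk h1.walk
      have h1 := (hz'.isLevelUpdate hsymm hcap).levelArcs_subset H
      rw [h0, Finset.subset_empty] at h1
      rw [h1, h0]
      simp

theorem maxFlowRounds_spec (hst : s ≠ t) (hloop : ∀ v, (v, v) ∉ E)
    (hsymm : ∀ u v, (u, v) ∈ E → (v, u) ∈ E) {ν : V × V → ℝ} (hν : ∀ e ∈ E, 0 ≤ ν e)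
    {σ : FlowVar V → ℝ} (hσ : ∀ e ∈ E, σ (FlowVar.nu e.1 e.2) = ν e) (r : ℕ) :
    MainInv E s t ν ((maxFlowRounds E s t r).run σ) ∧
    NoShortWalk E (capacityOf ((maxFlowRounds E s t r).run σ)) s t (r + 1) := by
  obtain ⟨σ₁, hσ₁⟩ : ∃ σ₁, σ₁ = (forPar (forwardArcs E).toList fun e =>
      block [
        MAAP.set (x e.1 e.2) (.num 0),
        MAAP.set (FlowVar.c e.1 e.2) (.var (nu e.1 e.2)),
        MAAP.set (FlowVar.c e.2 e.1) (.var (nu e.2 e.1))]).run σ := ⟨_, rfl⟩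
  have hfwd : ∀ u v, (u, v) ∈ E → u < v →
      σ₁ (x u v) = 0 ∧ σ₁ (FlowVar.c u v) = ν (u, v) ∧ σ₁ (FlowVar.c v u) = ν (v, u) := by
    intro u v hE huv
    have h1 : σ (nu u v) = ν (u, v) := hσ (u, v) hE
    have h2 : σ (nu v u) = ν (v, u) := hσ (v, u) (hsymm _ _ hE)
    refine ⟨?_, ?_, ?_⟩
    all_goals
      rw [hσ₁, run_forPar_of_mem (i := (u, v)) (by simp [hE, huv]) (by simp [assigned, MAAP.set])
        (by simp [assigned, MAAP.set]; grind)]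
      simp [run, MAAP.set, MaxAffine.eval, Affine.eval, Affine.num, Affine.var,
        Function.update_apply, h1, h2, huv.ne, huv.ne']
  have hcap : ∀ e ∈ E, capacityOf σ₁ e = ν e := by
    rintro ⟨u, v⟩ he
    rcases lt_trichotomy u v with huv | rfl | huv
    · exact (hfwd u v he huv).2.1
    · exact absurd he (hloop u)
    · exact (hfwd v u (hsymm _ _ he) huv).2.2
  have hinit : MainInv E s t ν σ₁ := by
    refine ⟨fun e he => (hν e he).trans (hcap e he).ge, ?_, fun v _ _ => ?_⟩
    · rintro ⟨u, v⟩ he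
      rw [hcap _ he]
      rcases lt_trichotomy u v with huv | rfl | huv
      · simp [residualCapacity, valueOf, huv, (hfwd u v he huv).1]
      · exact absurd he (hloop u)
      · simp [residualCapacity, valueOf, huv.not_gt, (hfwd v u (hsymm _ _ he) huv).1]
    · refine Finset.sum_eq_zero fun e he => ?_
      rw [hcap e (Finset.mem_filter.1 he).1, sub_self]
  have hrun : (maxFlowRounds E s t r).run σ = (forDo (List.range' 1 r) fun k =>
      forDo (List.range' 1 E.card) fun _ => augmentStep E s t k).run σ₁ := by
    rw [hσ₁]
    rfl
  rw [hrun, add_comm r 1]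
  refine forDo_range'_induction
    (fun k σ => MainInv E s t ν σ ∧ NoShortWalk E (capacityOf σ) s t k) 1 r ?_ ⟨hinit, ?_⟩
  · rintro k σ hk - ⟨h1, h2⟩
    have key := forDo_range'_induction (body := fun _ => augmentStep E s t k)
      -- The counter runs from `1` to `1 + E.card`, so the bound falls from `E.card` to `0`.
      (fun i σ => MainInv E s t ν σ ∧ NoShortWalk E (capacityOf σ) s t k ∧
        (levelArcs E (capacityOf σ) s t k).card ≤ E.card + 1 - i) 1 E.card
      (by
        rintro i σ - - ⟨h1, h2, h3⟩
        obtain ⟨h4, h5, h6⟩ := augmentStep_spec hst hloop hsymm hk h1 h2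
        exact ⟨h4, h5, by omega⟩)
      ⟨h1, h2, by
        rw [Nat.add_sub_cancel]
        exact card_levelArcs_le⟩
    exact ⟨key.1, key.2.1.of_card_levelArcs_eq_zero hk (by have := key.2.2; omega)⟩
  · intro i hi hw
    obtain rfl : i = 0 := by omega
    exact hst hw

end Program

/-! ### Correctness of the maximum flow program -/

theorem theorem2 {V : Type*} [Fintype V] [LinearOrder V] (E : Finset (V × V)) (s t : V)
    (hst : s ≠ t) (hloop : ∀ v, (v, v) ∉ E) (hsymm : ∀ u v, (u, v) ∈ E → (v, u) ∈ E) :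
    (maxFlowMAAP E s t).WellFormed ∧
    ∀ (ν : V × V → ℝ) (σ : FlowVar V → ℝ), (∀ e ∈ E, 0 ≤ ν e) →
      (∀ e ∈ E, σ (FlowVar.nu e.1 e.2) = ν e) →
      IsMaxFlow E s t ν
        (arcFlow fun e => (maxFlowMAAP E s t).run σ (FlowVar.x e.1 e.2)) ∧
      ∀ r ≤ Fintype.card V - 1, ∀ x c : V × V → ℝ,
        (∀ e, x e = (maxFlowRounds E s t r).run σ (FlowVar.x e.1 e.2)) →
        (∀ e, c e = (maxFlowRounds E s t r).run σ (FlowVar.c e.1 e.2)) →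
        IsFlow E s t ν (arcFlow x) ∧
        (∀ e ∈ E, c e = residualCapacity ν x e) ∧
        ∀ k ≤ r, ¬ WalkOfLength (ResidualArc E c) k s t := by
  refine ⟨wellFormed_maxFlowRounds _, fun ν σ hν hσ => ?_⟩
  have hflow : ∀ r, IsFlow E s t ν (arcFlow (valueOf ((maxFlowRounds E s t r).run σ))) := by
    intro r
    obtain ⟨h, -⟩ := maxFlowRounds_spec hst hloop hsymm hν hσ r
    refine ⟨fun e he => arcFlow_mem_Icc hν
      (fun e he => (h.capacity_nonneg e he).trans (h.capacity_eq e he).le) he, fun v hvs hvt => ?_⟩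
    rw [netOutflow_arcFlow hloop hsymm h.capacity_eq]
    exact h.conservation v hvs hvt
  refine ⟨?_, ?_⟩
  · obtain ⟨h, H⟩ := maxFlowRounds_spec hst hloop hsymm hν hσ (Fintype.card V - 1)
    refine isMaxFlow_of_no_residual_walk hloop hsymm (hflow _) h.capacity_eq fun k hk => ?_
    -- The rounds exclude only walks with at most `Fintype.card V - 1` arcs; any longer walk
    -- shortens to one of these.
    obtain ⟨j, hj, hw⟩ := hk.exists_lt_card
    exact H j (by omega) hw
  · intro r _ x c hx hc
    obtain ⟨h, H⟩ := maxFlowRounds_spec hst hloop hsymm hν hσ r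
    obtain rfl : x = valueOf ((maxFlowRounds E s t r).run σ) := funext hx
    obtain rfl : c = capacityOf ((maxFlowRounds E s t r).run σ) := funext hc
    exact ⟨hflow r, h.capacity_eq, fun k hk => H k (by omega)⟩
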